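/- Let $X_0, X_1$ be Banach spaces, $X_1\hookrightarrow X_0$ continuously and densely, let $p\in(1,\infty)$, $0<T_0<\infty$, $J_0=[0,T_0]$. For an interval $I$ put ${\rm MR}(I)=W^{1,p}(I;X_0)\cap L^p(I;X_1)$, with norm $\|u\|_{{\rm MR}(I)}=\|u\|_{L^p(I;X_0)}+\|u'\|_{L^p(I;X_0)}+\|u\|_{L^p(I;X_1)}$; functions in ${\rm MR}(I)$ are identified with their continuous $X_0$-valued versions. Let $X_p=(X_0,X_1)_{1-\frac1p,p}$ be described by the trace method: $X_p=\{u(0): u\in {\rm MR}(\mathbb R_+)\}$ with norm $\|x\|_{X_p}=\inf\{\|u\|_{{\rm MR}(\mathbb R_+)}: u\in {\rm MR}(\mathbb R_+),\ u(0)=x\}$. Let $A:J_0\times X_p\to\mathcal L(X_1,X_0)$ be such that $t\mapsto A(t,x)y$ is strongly measurable for all $x\in X_p$, $y\in X_1$, and for each $R>0$ there is a constant $C(R)>0$ with $$\|A(t,x_1)y-A(t,x_2)y\|_{X_0}\le C(R)\|x_1-x_2\|_{X_p}\|y\|_{X_1}$$ for all $t\in J_0$, $y\in X_1$ and $x_1,x_2\in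 X_p$ with $\|x_1\|_{X_p},\|x_2\|_{X_p}\le R$. Let $F:J_0\times X_p\to X_0$ be such that $F(\cdot,x)$ is strongly measurable for each $x\in X_p$, $F(t,\cdot)$ is continuous on $X_p$ for a.a. $t\in J_0$, $F(\cdot,0)\in L^p(J_0;X_0)$, and for each $R>0$ there is $\phi_R\in L^p(J_0)$ with $$\|F(t,x_1)-F(t,x_2)\|_{X_0}\le\phi_R(t)\|x_1-x_2\|_{X_p}$$ for a.a. $t\in J_0$ and all $x_1,x_2\in X_p$ with $\|x_1\|_{X_p},\|x_2\|_{X_p}\le R$. Let $x_0\in X_p$. Assume that $\sup_{t\in J_0}\|A(t,x_0)\|_{\mathcal L(X_1,X_0)}<\infty$ and that $A(\cdot,x_0)$ has maximal $L^p$-regularity on $(0,\tau)$ for every $\tau\in(0,T_0]$, that is: there is a constant $K_\tau$ such that for every $f\in L^p(0,\tau;X_0)$ the problem $u'(t)+A(t,x_0)u(t)=f(t)$ for a.a. $t\in(0,\tau)$, $u(0)=0$, has a unique strong solution $u\in W^{1,1}(0,\tau;X_0)\cap L^1(0,\tau;X_1)$, and this solution satisfies $u\in{\rm MR}((0,\tau))$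 and $\|u\|_{{\rm MR}((0,\tau))}\le K_\tau\|f\|_{L^p(0,\tau;X_0)}$. Then there are $T\in(0,T_0]$ and $\varepsilon>0$ such that, with $J=[0,T]$ and $B_\varepsilon=\{y\in X_p:\|y-x_0\|_{X_p}\le\varepsilon\}$, for every $x\in B_\varepsilon$ the problem $$u'(t)+A(t,u(t))u(t)=F(t,u(t))\ \text{ for a.a. } t\in J,\qquad u(0)=x,$$ has a unique solution $u=u^x$ in ${\rm MR}(J)$, and $u^x(t)\in X_p$ for all $t\in J$. Moreover, there is a constant $C$ such that for all $x,y\in B_\varepsilon$ $$\|u^x-u^y\|_{{\rm MR}(J)}\le C\|x-y\|_{X_p}.$$ -/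

import Mathlib

open MeasureTheory Set
open scoped ENNReal

noncomputable section

/-- The maximal regularity space `W^{1,p}(I; X₀) ∩ L^p(I; X₁)` on a closed interval `I`, where `X₁`
is embedded into `X₀` by `j`. An element is given by
* `val`, the continuous version of the function,
* `deriv`, its weak derivative: a function in `W^{1,p}` is precisely one whose continuous version is
  a primitive of a function in `L^p`,
* `lift`, the same function regarded as an `X₁`-valued function (it determines and, for injective
  `j`, is determined by `val` up to null sets).
Values outside `I` are irrelevant. -/
structure MRSpace {X₀ X₁ : Type*} [NormedAddCommGroup X₀] [NormedSpace ℝ X₀]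
    [NormedAddCommGroup X₁] [NormedSpace ℝ X₁] (j : X₁ →L[ℝ] X₀) (p : ℝ≥0∞) (I : Set ℝ) where
  val : ℝ → X₀
  deriv : ℝ → X₀
  lift : ℝ → X₁
  memLp_val : MemLp val p (volume.restrict I)
  memLp_deriv : MemLp deriv p (volume.restrict I)
  memLp_lift : MemLp lift p (volume.restrict I)
  lift_eq : ∀ᵐ t ∂(volume.restrict I), j (lift t) = val t
  sub_eq_integral : ∀ s ∈ I, ∀ t ∈ I, IntervalIntegrable deriv volume s t ∧
    val t - val s = ∫ r in s..t, deriv r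

namespace MRSpace

variable {X₀ X₁ : Type*} [NormedAddCommGroup X₀] [NormedSpace ℝ X₀]
  [NormedAddCommGroup X₁] [NormedSpace ℝ X₁] {j : X₁ →L[ℝ] X₀} {p : ℝ≥0∞} {I : Set ℝ}

/-- The norm `‖u‖_{W^{1,p}(I; X₀)} + ‖u‖_{L^p(I; X₁)}`, where
`‖u‖_{W^{1,p}(I; X₀)} = ‖u‖_{L^p(I; X₀)} + ‖u'‖_{L^p(I; X₀)}`. -/
def norm (u : MRSpace j p I) : ℝ :=
  (eLpNorm u.val p (volume.restrict I)).toReal + (eLpNorm u.deriv p (volume.restrict I)).toReal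
    + (eLpNorm u.lift p (volume.restrict I)).toReal

instance : Sub (MRSpace j p I) where
  sub u v :=
    { val := u.val - v.val
      deriv := u.deriv - v.deriv
      lift := u.lift - v.lift
      memLp_val := u.memLp_val.sub v.memLp_val
      memLp_deriv := u.memLp_deriv.sub v.memLp_deriv
      memLp_lift := u.memLp_lift.sub v.memLp_lift
      lift_eq := by
        filter_upwards [u.lift_eq, v.lift_eq] with t hu hv
        simp [hu, hv]
      sub_eq_integral := by
        intro s hs t ht
        obtain ⟨hu, hu'⟩ := u.sub_eq_integral s hs t ht
        obtain ⟨hv, hv'⟩ := v.sub_eq_integral s hs t ht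
        refine ⟨hu.sub hv, ?_⟩
        have h := intervalIntegral.integral_sub hu hv
        simp only [Pi.sub_apply]
        rw [h, ← hu', ← hv']
        abel }

end MRSpace

section

variable {X₀ X₁ : Type*} [NormedAddCommGroup X₀] [NormedSpace ℝ X₀]
  [NormedAddCommGroup X₁] [NormedSpace ℝ X₁]

/-- The space `X_p = (X₀, X₁)_{1 - 1/p, p}`, described by the trace method: all initial values
`u(0)` of functions `u ∈ W^{1,p}(ℝ₊; X₀) ∩ L^p(ℝ₊; X₁)`. -/
def traceSpace (j : X₁ →L[ℝ] X₀) (p : ℝ≥0∞) : Set X₀ :=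
  {x | ∃ u : MRSpace j p (Ici 0), u.val 0 = x}

/-- The norm of `X_p`: the infimum of `‖u‖_{W^{1,p}(ℝ₊; X₀) ∩ L^p(ℝ₊; X₁)}` over all `u` with
`u(0) = x`. It is only meaningful for `x ∈ X_p`. -/
def traceNorm (j : X₁ →L[ℝ] X₀) (p : ℝ≥0∞) (x : X₀) : ℝ :=
  ⨅ u : {u : MRSpace j p (Ici 0) // u.val 0 = x}, u.1.norm

/-- `u` solves `u' + A(t) u = f` a.e. on `(a, b)`, `u(a) = x`. For `q = 1` such a `u` is a strong
solution, that is, a solution in `W^{1,1}(a,b; X₀) ∩ L^1(a,b; X₁) ∩ C([a,b]; X₀)`. -/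
def IsLinearSolution {j : X₁ →L[ℝ] X₀} {q : ℝ≥0∞} {a b : ℝ} (A : ℝ → X₁ →L[ℝ] X₀) (f : ℝ → X₀)
    (x : X₀) (u : MRSpace j q (Icc a b)) : Prop :=
  u.val a = x ∧ ∀ᵐ t ∂(volume.restrict (Icc a b)), u.deriv t + A t (u.lift t) = f t

/-- Maximal `L^p`-regularity on the bounded interval `(a, b)`: for every `f ∈ L^p(a,b; X₀)` the
problem `u' + A(t) u = f`, `u(a) = 0`, has a unique strong solution `u`, and
`‖u‖_{W^{1,p}(X₀) ∩ L^p(X₁)} ≤ C ‖f‖_{L^p(X₀)}` with `C` independent of `f`. -/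
def HasMaximalRegularity (j : X₁ →L[ℝ] X₀) (p : ℝ≥0∞) (a b : ℝ) (A : ℝ → X₁ →L[ℝ] X₀) : Prop :=
  ∃ C : ℝ, ∀ f : ℝ → X₀, MemLp f p (volume.restrict (Icc a b)) →
    ∃ u : MRSpace j p (Icc a b), IsLinearSolution A f 0 u ∧
      u.norm ≤ C * (eLpNorm f p (volume.restrict (Icc a b))).toReal ∧
      ∀ v : MRSpace j 1 (Icc a b), IsLinearSolution A f 0 v → EqOn v.val u.val (Icc a b)

/-- `u ∈ W^{1,p}(J; X₀) ∩ L^p(J; X₁)`, `J = [0, T]`, solves the quasilinear problem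
`u'(t) + A(t, u(t)) u(t) = F(t, u(t))` for a.e. `t ∈ J`, `u(0) = x`. -/
def IsQuasilinearSolution {j : X₁ →L[ℝ] X₀} {p : ℝ≥0∞} {T : ℝ} (A : ℝ → X₀ → X₁ →L[ℝ] X₀)
    (F : ℝ → X₀ → X₀) (x : X₀) (u : MRSpace j p (Icc 0 T)) : Prop :=
  u.val 0 = x ∧ ∀ᵐ t ∂(volume.restrict (Icc 0 T)),
    u.deriv t + A t (u.val t) (u.lift t) = F t (u.val t)

end

end

/-! Freeze the operator at `x₀` and write the problem as `u' + A(t, x₀)u = N(u)` with `N(u) = (A(t,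
x₀) - A(t, u))u + F(t, u)`. For `u` with values near `x₀` in `X_p` and small norm in MR, the first
part of `N` is quadratically small, and the second is small on short intervals because `φ_R` and
`F(·, x₀)` have small `L^p`-norm there. Two constants must not deteriorate as the interval shrinks.
The constant of maximal regularity is uniform because right-hand sides can be extended by zero to
`(0, T₀)` (`exists_isUniformlyMaximallyRegular`). The embedding into `C([0, T]; X_p)` has norm at
most one on functions vanishing at zero, because these can be reversed in time and extended by zero
to the half-line (`MRSpace.exists_reverse`, `MRSpace.traceNorm_val_le_of_val_zero`). Nonzero initial
values are handled by subtracting half-line functions. Existence is Banach's fixed point theorem for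
the right-hand side `g ↦ N(v)`, where `v` solves the linear problem with data `g` and `x`, in a ball
of `L^p(0, T; X₀)`; only completeness of `L^p` is needed. Uniqueness and Lipschitz dependence rest
on `lpNormOn_perturbation_sub_le`, in which only one of the two solutions has to stay near `x₀`. An
arbitrary second solution is compared with the constructed one on successive short windows
(`IsQuasilinearSolution.eqOn`), so uniqueness holds in all of MR. Hence every solution inherits the
bounds of the constructed one, and `IsQuasilinearSolution.norm_sub_le` gives the Lipschitz estimate.
-/

noncomputable section

open Filter Topology

/-! ### `L^p`-norms over subsets of the line. -/

section LpNormOn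

variable {E E' : Type*} [NormedAddCommGroup E] [NormedAddCommGroup E'] {p : ℝ≥0∞} {I J : Set ℝ}

/-- The `L^p`-norm over a set of reals, as a real number. -/
def lpNormOn (f : ℝ → E) (p : ℝ≥0∞) (I : Set ℝ) : ℝ :=
  (eLpNorm f p (volume.restrict I)).toReal

theorem lpNormOn_nonneg (f : ℝ → E) (p : ℝ≥0∞) (I : Set ℝ) : 0 ≤ lpNormOn f p I :=
  ENNReal.toReal_nonneg

theorem lpNormOn_mono_set {f : ℝ → E} (hf : MemLp f p (volume.restrict J)) (h : I ⊆ J) :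
    lpNormOn f p I ≤ lpNormOn f p J :=
  ENNReal.toReal_mono hf.2.ne (eLpNorm_mono_measure f (Measure.restrict_mono h le_rfl))

theorem lpNormOn_mono_ae {f : ℝ → E} {g : ℝ → E'} (hg : MemLp g p (volume.restrict I))
    (h : ∀ᵐ t ∂(volume.restrict I), ‖f t‖ ≤ ‖g t‖) : lpNormOn f p I ≤ lpNormOn g p I :=
  ENNReal.toReal_mono hg.2.ne (eLpNorm_mono_ae h)

theorem lpNormOn_congr_ae {f g : ℝ → E} (h : f =ᵐ[volume.restrict I] g) :
    lpNormOn f p I = lpNormOn g p I := by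
  rw [lpNormOn, eLpNorm_congr_ae h, lpNormOn]

theorem lpNormOn_add_le {f g : ℝ → E} (hp : 1 ≤ p) (hf : MemLp f p (volume.restrict I))
    (hg : MemLp g p (volume.restrict I)) :
    lpNormOn (f + g) p I ≤ lpNormOn f p I + lpNormOn g p I := by
  rw [lpNormOn, lpNormOn, lpNormOn, ← ENNReal.toReal_add hf.2.ne hg.2.ne]
  exact ENNReal.toReal_mono (ENNReal.add_ne_top.2 ⟨hf.2.ne, hg.2.ne⟩)
    (eLpNorm_add_le hf.1 hg.1 hp)

theorem lpNormOn_neg (f : ℝ → E) : lpNormOn (-f) p I = lpNormOn f p I := by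
  rw [lpNormOn, eLpNorm_neg, lpNormOn]

theorem lpNormOn_norm_smul (f : ℝ → E) (c : ℝ) :
    lpNormOn (fun t => c * ‖f t‖) p I = |c| * lpNormOn f p I := by
  have : (fun t => c * ‖f t‖) = c • fun t => ‖f t‖ := rfl
  rw [lpNormOn, this, eLpNorm_const_smul, eLpNorm_norm, ENNReal.toReal_mul, lpNormOn]
  simp

theorem lpNormOn_zero : lpNormOn (0 : ℝ → E) p I = 0 := by
  simp [lpNormOn]

theorem lpNormOn_le_of_le_add {F₁ F₂ : Type*} [NormedAddCommGroup F₁] [NormedAddCommGroup F₂]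
    {f : ℝ → E} {g₁ : ℝ → F₁} {g₂ : ℝ → F₂} {a b : ℝ} (hp : 1 ≤ p) (ha : 0 ≤ a) (hb : 0 ≤ b)
    (hg₁ : MemLp g₁ p (volume.restrict I)) (hg₂ : MemLp g₂ p (volume.restrict I))
    (h : ∀ᵐ t ∂(volume.restrict I), ‖f t‖ ≤ a * ‖g₁ t‖ + b * ‖g₂ t‖) :
    lpNormOn f p I ≤ a * lpNormOn g₁ p I + b * lpNormOn g₂ p I := by
  have h1 : MemLp (fun t => a * ‖g₁ t‖) p (volume.restrict I) := hg₁.norm.const_mul a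
  have h2 : MemLp (fun t => b * ‖g₂ t‖) p (volume.restrict I) := hg₂.norm.const_mul b
  have h3 := lpNormOn_add_le hp h1 h2
  rw [lpNormOn_norm_smul, lpNormOn_norm_smul, abs_of_nonneg ha, abs_of_nonneg hb] at h3
  refine (lpNormOn_mono_ae (h1.add h2) ?_).trans h3
  filter_upwards [h] with t ht
  exact ht.trans (le_abs_self _)

theorem lpNormOn_indicator {f : ℝ → E} (hI : MeasurableSet I) (h : I ⊆ J) :
    lpNormOn (I.indicator f) p J = lpNormOn f p I := by
  rw [lpNormOn, eLpNorm_indicator_eq_eLpNorm_restrict hI, Measure.restrict_restrict hI,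
    inter_eq_left.2 h, lpNormOn]

/-- Absolute continuity of the `L^p`-norm. -/
theorem exists_lpNormOn_Icc_le {f : ℝ → E} (hp : 1 ≤ p) (hp' : p ≠ ∞)
    (hf : MemLp f p (volume.restrict I)) {η : ℝ} (hη : 0 < η) :
    ∃ δ : ℝ, 0 < δ ∧ ∀ a b : ℝ, Icc a b ⊆ I → b - a ≤ δ → lpNormOn f p (Icc a b) ≤ η := by
  obtain ⟨δ, hδ, h⟩ := hf.eLpNorm_indicator_le hp hp' hη
  refine ⟨δ, hδ, fun a b hab hδab => ?_⟩
  have := h (Icc a b) measurableSet_Icc ((Measure.restrict_apply_le _ _).trans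
    (by rw [Real.volume_Icc]; exact ENNReal.ofReal_le_ofReal hδab))
  rw [← lpNormOn_indicator measurableSet_Icc hab, lpNormOn]
  exact ENNReal.toReal_le_of_le_ofReal hη.le this

/-- Continuity of reparametrisation by translations in `L^p` of a half-line. -/
theorem tendsto_lpNormOn_translate {f : ℝ → E} (hp : 1 ≤ p) (hp' : p ≠ ∞)
    (hf : MemLp f p (volume.restrict (Ici 0))) {s : ℝ} (hs : 0 ≤ s) :
    Tendsto (fun t => lpNormOn ((fun r => f (t + r)) - fun r => f (s + r)) p (Ici 0))
      (𝓝[Ici 0] s) (𝓝 0) := by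
  have : Fact (1 ≤ p) := ⟨hp⟩
  -- Extension by zero reduces the claim to strong continuity of the translations on `L^p(ℝ)`. Only
  -- nonnegative shifts occur, so on the half-line the extension agrees with `f`.
  set g : ℝ → E := (Ici 0).indicator f with hg
  have hgm : MemLp g p volume := (memLp_indicator_iff_restrict measurableSet_Ici).2 hf
  have hmp : ∀ t : ℝ, MeasurePreserving (fun r : ℝ => t + r) volume volume :=
    fun t => measurePreserving_add_left volume t
  let c : C(ℝ, C(ℝ, ℝ)) := (ContinuousMap.mk (fun q : ℝ × ℝ => q.1 + q.2) (by fun_prop)).curry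
  have key : Tendsto (fun t => Lp.compMeasurePreserving (fun r : ℝ => t + r) (hmp t)
      (hgm.toLp g)) (𝓝 s) (𝓝 (Lp.compMeasurePreserving (fun r : ℝ => s + r) (hmp s)
      (hgm.toLp g))) :=
    Filter.Tendsto.compMeasurePreservingLp (g := fun t => c t) (g₀ := c s) tendsto_const_nhds
      (c.continuous.tendsto s) hmp (hmp s) hp'
  have key2 := (tendsto_iff_norm_sub_tendsto_zero.1 key).mono_left
    (nhdsWithin_le_nhds (s := Ici 0))
  refine squeeze_zero' (Eventually.of_forall fun _ => lpNormOn_nonneg _ _ _) ?_ key2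
  filter_upwards [self_mem_nhdsWithin] with t ht
  rw [Lp.toLp_compMeasurePreserving, Lp.toLp_compMeasurePreserving, ← MemLp.toLp_sub,
    Lp.norm_toLp]
  have hmem := ((hgm.comp_measurePreserving (hmp t)).sub (hgm.comp_measurePreserving (hmp s)))
  refine ENNReal.toReal_mono hmem.2.ne ?_
  refine le_trans (le_of_eq (eLpNorm_congr_ae ?_)) (eLpNorm_restrict_le _ p volume (Ici 0))
  filter_upwards [ae_restrict_mem measurableSet_Ici] with r hr
  have h1 : (0:ℝ) ≤ t + r := add_nonneg ht hr
  have h2 : (0:ℝ) ≤ s + r := add_nonneg hs hr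
  simp [hg, h1, h2]

end LpNormOn

/-- Measurability of superposition operators for Carathéodory functions. -/
theorem aestronglyMeasurable_caratheodory {α Y E : Type*} [MeasurableSpace α]
    [TopologicalSpace Y] [NormedAddCommGroup E] {μ : Measure α} {H : Y → α → E}
    (hH : ∀ y, AEStronglyMeasurable (H y) μ) (hc : ∀ᵐ t ∂μ, Continuous fun y => H y t)
    {κ : α → Y} (hκ : AEStronglyMeasurable κ μ) :
    AEStronglyMeasurable (fun t => H (κ t) t) μ := by
  obtain ⟨κ', hκ', he⟩ := hκ
  refine AEStronglyMeasurable.congr (f := fun t => H (κ' t) t) ?_ ?_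
  -- For a simple function in place of `κ'` the superposition is a finite sum of indicators;
  -- continuity in `y` passes this to the limit.
  · refine aestronglyMeasurable_of_tendsto_ae atTop (f := fun n t => H (hκ'.approx n t) t)
      (fun n => ?_) ?_
    · set σ := hκ'.approx n
      have : (fun t => H (σ t) t) =
          fun t => ∑ y ∈ σ.range, (σ ⁻¹' {y}).indicator (H y) t := by
        funext t
        rw [Finset.sum_eq_single (σ t)]
        · simp
        · intro y _ hy
          exact indicator_of_notMem (fun h => hy h.symm) _
        · intro h
          exact absurd (SimpleFunc.mem_range_self σ t) h
      rw [this]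
      exact Finset.aestronglyMeasurable_fun_sum _
        fun y _ => (hH y).indicator (σ.measurableSet_fiber y)
    · filter_upwards [hc] with t ht
      exact (ht.tendsto _).comp (hκ'.tendsto_approx t)
  · filter_upwards [he] with t ht
    rw [ht]

/-! ### Translation and reversal of time in `L^p`. -/

section HalfLine

variable {E : Type*} [NormedAddCommGroup E] {p : ℝ≥0∞} {f : ℝ → E} {s T : ℝ}

theorem measurePreserving_const_add_Ici (s : ℝ) :
    MeasurePreserving (fun r : ℝ => s + r) (volume.restrict (Ici 0)) (volume.restrict (Ici s)) := by
  have := (measurePreserving_add_left volume s).restrict_preimage (measurableSet_Ici (a := s))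
  rwa [show (fun r : ℝ => s + r) ⁻¹' Ici s = Ici 0 by ext r; simp] at this

theorem lpNormOn_translate_le (hf : MemLp f p (volume.restrict (Ici 0))) (hs : 0 ≤ s) :
    lpNormOn (fun r => f (s + r)) p (Ici 0) ≤ lpNormOn f p (Ici 0) := by
  have hsub : Ici s ⊆ Ici (0 : ℝ) := Ici_subset_Ici.2 hs
  have h := eLpNorm_comp_measurePreserving (p := p)
    (hf.mono_measure (Measure.restrict_mono hsub le_rfl)).1 (measurePreserving_const_add_Ici s)
  refine le_trans (le_of_eq ?_) (lpNormOn_mono_set hf hsub)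
  rw [lpNormOn, lpNormOn, ← h]
  rfl

theorem measurePreserving_const_sub_Icc (T : ℝ) :
    MeasurePreserving (fun r : ℝ => T - r) (volume.restrict (Icc 0 T))
      (volume.restrict (Icc 0 T)) := by
  have := (Measure.measurePreserving_sub_left volume T).restrict_preimage
    (measurableSet_Icc (a := (0 : ℝ)) (b := T))
  rwa [show (fun r : ℝ => T - r) ⁻¹' Icc 0 T = Icc 0 T by simp] at this

theorem memLp_reverse (hf : MemLp f p (volume.restrict (Icc 0 T))) :
    MemLp ((Icc 0 T).indicator fun r => f (T - r)) p (volume.restrict (Ici 0)) := by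
  rw [memLp_indicator_iff_restrict measurableSet_Icc, Measure.restrict_restrict measurableSet_Icc,
    inter_eq_left.2 Icc_subset_Ici_self]
  exact hf.comp_measurePreserving (measurePreserving_const_sub_Icc T)

theorem lpNormOn_reverse (hf : MemLp f p (volume.restrict (Icc 0 T))) :
    lpNormOn ((Icc 0 T).indicator fun r => f (T - r)) p (Ici 0) = lpNormOn f p (Icc 0 T) := by
  rw [lpNormOn_indicator measurableSet_Icc Icc_subset_Ici_self, lpNormOn, lpNormOn,
    ← eLpNorm_comp_measurePreserving hf.1 (measurePreserving_const_sub_Icc T)]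
  rfl

end HalfLine

/-! ### The maximal regularity space: norm, restriction, translation, reversal. -/

section MaximalRegularitySpace

variable {X₀ X₁ : Type*} [NormedAddCommGroup X₀] [NormedSpace ℝ X₀]
  [NormedAddCommGroup X₁] [NormedSpace ℝ X₁] {j : X₁ →L[ℝ] X₀} {p : ℝ≥0∞} {I J : Set ℝ}

namespace MRSpace

theorem norm_eq (u : MRSpace j p I) :
    u.norm = lpNormOn u.val p I + lpNormOn u.deriv p I + lpNormOn u.lift p I := rfl

theorem norm_nonneg (u : MRSpace j p I) : 0 ≤ u.norm := by
  rw [norm_eq]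
  have := lpNormOn_nonneg u.val p I
  have := lpNormOn_nonneg u.deriv p I
  have := lpNormOn_nonneg u.lift p I
  positivity

theorem lpNormOn_deriv_le (u : MRSpace j p I) : lpNormOn u.deriv p I ≤ u.norm := by
  rw [norm_eq]
  linarith [lpNormOn_nonneg u.val p I, lpNormOn_nonneg u.lift p I]

theorem lpNormOn_lift_le (u : MRSpace j p I) : lpNormOn u.lift p I ≤ u.norm := by
  rw [norm_eq]
  linarith [lpNormOn_nonneg u.val p I, lpNormOn_nonneg u.deriv p I]

instance : Zero (MRSpace j p I) where
  zero :=
    { val := 0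
      deriv := 0
      lift := 0
      memLp_val := MemLp.zero
      memLp_deriv := MemLp.zero
      memLp_lift := MemLp.zero
      lift_eq := by simp
      sub_eq_integral := by
        intro s _ t _
        exact ⟨intervalIntegrable_const (c := (0 : X₀)), by simp⟩ }

instance : Neg (MRSpace j p I) where
  neg u :=
    { val := -u.val
      deriv := -u.deriv
      lift := -u.lift
      memLp_val := u.memLp_val.neg
      memLp_deriv := u.memLp_deriv.neg
      memLp_lift := u.memLp_lift.neg
      lift_eq := by
        filter_upwards [u.lift_eq] with t hu
        simp [hu]
      sub_eq_integral := by
        intro s hs t ht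
        obtain ⟨hu, hu'⟩ := u.sub_eq_integral s hs t ht
        refine ⟨hu.neg, ?_⟩
        simp only [Pi.neg_apply, intervalIntegral.integral_neg, ← hu']
        abel }

instance : Add (MRSpace j p I) where
  add u v :=
    { val := u.val + v.val
      deriv := u.deriv + v.deriv
      lift := u.lift + v.lift
      memLp_val := u.memLp_val.add v.memLp_val
      memLp_deriv := u.memLp_deriv.add v.memLp_deriv
      memLp_lift := u.memLp_lift.add v.memLp_lift
      lift_eq := by
        filter_upwards [u.lift_eq, v.lift_eq] with t hu hv
        simp [hu, hv]
      sub_eq_integral := by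
        intro s hs t ht
        obtain ⟨hu, hu'⟩ := u.sub_eq_integral s hs t ht
        obtain ⟨hv, hv'⟩ := v.sub_eq_integral s hs t ht
        refine ⟨hu.add hv, ?_⟩
        have h := intervalIntegral.integral_add hu hv
        simp only [Pi.add_apply]
        rw [h, ← hu', ← hv']
        abel }

@[simp] theorem zero_val : (0 : MRSpace j p I).val = 0 := rfl
@[simp] theorem zero_deriv : (0 : MRSpace j p I).deriv = 0 := rfl
@[simp] theorem zero_lift : (0 : MRSpace j p I).lift = 0 := rfl
@[simp] theorem neg_val (u : MRSpace j p I) : (-u).val = -u.val := rfl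
@[simp] theorem neg_deriv (u : MRSpace j p I) : (-u).deriv = -u.deriv := rfl
@[simp] theorem neg_lift (u : MRSpace j p I) : (-u).lift = -u.lift := rfl
@[simp] theorem add_val (u v : MRSpace j p I) : (u + v).val = u.val + v.val := rfl
@[simp] theorem add_deriv (u v : MRSpace j p I) : (u + v).deriv = u.deriv + v.deriv := rfl
@[simp] theorem add_lift (u v : MRSpace j p I) : (u + v).lift = u.lift + v.lift := rfl
@[simp] theorem sub_val (u v : MRSpace j p I) : (u - v).val = u.val - v.val := rfl
@[simp] theorem sub_deriv (u v : MRSpace j p I) : (u - v).deriv = u.deriv - v.deriv := rfl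
@[simp] theorem sub_lift (u v : MRSpace j p I) : (u - v).lift = u.lift - v.lift := rfl

theorem norm_zero : (0 : MRSpace j p I).norm = 0 := by
  simp [norm_eq, lpNormOn_zero]

theorem norm_neg (u : MRSpace j p I) : (-u).norm = u.norm := by
  simp [norm_eq, lpNormOn_neg]

theorem norm_add_le (hp : 1 ≤ p) (u v : MRSpace j p I) : (u + v).norm ≤ u.norm + v.norm := by
  simp only [norm_eq, add_val, add_deriv, add_lift]
  linarith [lpNormOn_add_le hp u.memLp_val v.memLp_val,
    lpNormOn_add_le hp u.memLp_deriv v.memLp_deriv, lpNormOn_add_le hp u.memLp_lift v.memLp_lift]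

theorem norm_sub_le (hp : 1 ≤ p) (u v : MRSpace j p I) : (u - v).norm ≤ u.norm + v.norm := by
  have h := norm_add_le hp u (-v)
  rw [norm_neg] at h
  have h2 : (u - v).norm = (u + -v).norm := by
    simp only [norm_eq, add_val, add_deriv, add_lift, sub_val, sub_deriv, sub_lift, neg_val,
      neg_deriv, neg_lift, sub_eq_add_neg]
  rwa [h2]

/-- Restriction to a smaller set. -/
def restrict (u : MRSpace j p J) (h : I ⊆ J) : MRSpace j p I where
  val := u.val
  deriv := u.deriv
  lift := u.lift
  memLp_val := u.memLp_val.mono_measure (Measure.restrict_mono h le_rfl)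
  memLp_deriv := u.memLp_deriv.mono_measure (Measure.restrict_mono h le_rfl)
  memLp_lift := u.memLp_lift.mono_measure (Measure.restrict_mono h le_rfl)
  lift_eq := ae_restrict_of_ae_restrict_of_subset h u.lift_eq
  sub_eq_integral := fun s hs t ht => u.sub_eq_integral s (h hs) t (h ht)

@[simp] theorem restrict_val (u : MRSpace j p J) (h : I ⊆ J) : (u.restrict h).val = u.val := rfl
@[simp] theorem restrict_deriv (u : MRSpace j p J) (h : I ⊆ J) :
    (u.restrict h).deriv = u.deriv := rfl
@[simp] theorem restrict_lift (u : MRSpace j p J) (h : I ⊆ J) :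
    (u.restrict h).lift = u.lift := rfl

theorem norm_restrict_le (u : MRSpace j p J) (h : I ⊆ J) : (u.restrict h).norm ≤ u.norm := by
  simp only [norm_eq, restrict_val, restrict_deriv, restrict_lift]
  linarith [lpNormOn_mono_set u.memLp_val h, lpNormOn_mono_set u.memLp_deriv h,
    lpNormOn_mono_set u.memLp_lift h]

/-- On a bounded interval, `W^{1,p} ∩ L^p` is contained in `W^{1,1} ∩ L^1`. -/
def toOne {a b : ℝ} (u : MRSpace j p (Icc a b)) (hp : 1 ≤ p) : MRSpace j 1 (Icc a b) where
  val := u.val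
  deriv := u.deriv
  lift := u.lift
  memLp_val := u.memLp_val.mono_exponent hp
  memLp_deriv := u.memLp_deriv.mono_exponent hp
  memLp_lift := u.memLp_lift.mono_exponent hp
  lift_eq := u.lift_eq
  sub_eq_integral := u.sub_eq_integral

/-- The norm tends to zero when a bounded interval shrinks to a point. -/
theorem exists_norm_restrict_le (hp : 1 ≤ p) (hp' : p ≠ ∞) (w : MRSpace j p (Ici 0)) {η : ℝ}
    (hη : 0 < η) : ∃ δ : ℝ, 0 < δ ∧ 
      ∀ T ≤ δ, (w.restrict (I := Icc 0 T) Icc_subset_Ici_self).norm ≤ η := by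
  obtain ⟨δ₁, h₁, H₁⟩ := exists_lpNormOn_Icc_le hp hp' w.memLp_val (by positivity : 0 < η / 3)
  obtain ⟨δ₂, h₂, H₂⟩ := exists_lpNormOn_Icc_le hp hp' w.memLp_deriv (by positivity : 0 < η / 3)
  obtain ⟨δ₃, h₃, H₃⟩ := exists_lpNormOn_Icc_le hp hp' w.memLp_lift (by positivity : 0 < η / 3)
  refine ⟨min δ₁ (min δ₂ δ₃), by positivity, fun T hT => ?_⟩
  simp only [le_min_iff] at hT
  simp only [norm_eq, restrict_val, restrict_deriv, restrict_lift]
  linarith [H₁ 0 T Icc_subset_Ici_self (by linarith), H₂ 0 T Icc_subset_Ici_self (by linarith),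
    H₃ 0 T Icc_subset_Ici_self (by linarith)]

/-- Translation on the half-line. -/
def translate (w : MRSpace j p (Ici 0)) {s : ℝ} (hs : 0 ≤ s) : MRSpace j p (Ici 0) :=
  have hmp := measurePreserving_const_add_Ici s
  have hsub : Ici s ⊆ Ici (0 : ℝ) := Ici_subset_Ici.2 hs
  { val := fun r => w.val (s + r)
    deriv := fun r => w.deriv (s + r)
    lift := fun r => w.lift (s + r)
    memLp_val := (w.restrict hsub).memLp_val.comp_measurePreserving hmp
    memLp_deriv := (w.restrict hsub).memLp_deriv.comp_measurePreserving hmp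
    memLp_lift := (w.restrict hsub).memLp_lift.comp_measurePreserving hmp
    lift_eq := hmp.quasiMeasurePreserving.ae (w.restrict hsub).lift_eq
    sub_eq_integral := by
      intro a ha b hb
      obtain ⟨h1, h2⟩ := w.sub_eq_integral (s + a) (add_nonneg hs ha) (s + b) (add_nonneg hs hb)
      refine ⟨?_, by rw [h2, intervalIntegral.integral_comp_add_left]⟩
      rw [intervalIntegrable_iff] at h1 ⊢
      have h3 := (measurePreserving_add_left volume s).restrict_preimage
        (measurableSet_uIoc (a := s + a) (b := s + b))
      rw [show (fun r : ℝ => s + r) ⁻¹' uIoc (s + a) (s + b) = uIoc a b by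
        ext r
        simp only [uIoc, mem_preimage, mem_Ioc, min_add_add_left, max_add_add_left,
          add_lt_add_iff_left, add_le_add_iff_left]] at h3
      exact h3.integrable_comp_of_integrable h1 }

@[simp] theorem translate_val (w : MRSpace j p (Ici 0)) {s : ℝ} (hs : 0 ≤ s) :
    (w.translate hs).val = fun r => w.val (s + r) := rfl
@[simp] theorem translate_deriv (w : MRSpace j p (Ici 0)) {s : ℝ} (hs : 0 ≤ s) :
    (w.translate hs).deriv = fun r => w.deriv (s + r) := rfl
@[simp] theorem translate_lift (w : MRSpace j p (Ici 0)) {s : ℝ} (hs : 0 ≤ s) :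
    (w.translate hs).lift = fun r => w.lift (s + r) := rfl

theorem norm_translate_le (w : MRSpace j p (Ici 0)) {s : ℝ} (hs : 0 ≤ s) :
    (w.translate hs).norm ≤ w.norm := by
  simp only [norm_eq, translate_val, translate_deriv, translate_lift]
  linarith [lpNormOn_translate_le w.memLp_val hs, lpNormOn_translate_le w.memLp_deriv hs,
    lpNormOn_translate_le w.memLp_lift hs]

/-- Reversal of time, followed by extension by zero. -/
theorem exists_reverse {T : ℝ} (hT : 0 ≤ T) (d : MRSpace j p (Icc 0 T)) (hd : d.val 0 = 0) :
    ∃ w : MRSpace j p (Ici 0), (∀ s ∈ Icc 0 T, w.val (T - s) = d.val s) ∧ w.norm ≤ d.norm := by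
  have hmp := measurePreserving_const_sub_Icc T
  set D : ℝ → X₀ := (Icc 0 T).indicator fun r => -d.deriv (T - r) with hD
  have hI : IntegrableOn (fun r => d.deriv (T - r)) (Icc 0 T) := by
    have h1 := (d.sub_eq_integral 0 ⟨le_rfl, hT⟩ T ⟨hT, le_rfl⟩).1
    rw [intervalIntegrable_iff_integrableOn_Icc_of_le hT] at h1
    exact hmp.integrable_comp_of_integrable h1
  have hDint : Integrable D :=
    (integrable_indicator_iff measurableSet_Icc).2 hI.neg
  have hle : ∀ b, 0 ≤ b → b ≤ T → ∫ r in (0 : ℝ)..b, D r = d.val (T - b) - d.val T := by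
    intro b hb hbT
    have h2 := (d.sub_eq_integral T ⟨hT, le_rfl⟩ (T - b) ⟨by linarith, by linarith⟩).2
    rw [h2]
    have h3 : ∫ r in (0 : ℝ)..b, D r = ∫ r in (0 : ℝ)..b, -d.deriv (T - r) := by
      refine intervalIntegral.integral_congr fun r hr => ?_
      rw [uIcc_of_le hb] at hr
      exact indicator_of_mem (show r ∈ Icc 0 T from ⟨hr.1, hr.2.trans hbT⟩) _
    rw [h3, intervalIntegral.integral_neg, intervalIntegral.integral_comp_sub_left, sub_zero,
      intervalIntegral.integral_symm]
    simp
  have hgt : ∀ b, T ≤ b → ∫ r in T..b, D r = 0 := by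
    intro b hb
    rw [← intervalIntegral.integral_zero (a := T) (b := b)]
    refine intervalIntegral.integral_congr_ae (Eventually.of_forall fun r hr => ?_)
    rw [uIoc_of_le hb] at hr
    exact indicator_of_notMem (fun h => absurd h.2 (not_le.2 hr.1)) _
  -- The reversed function reaches `d(0) = 0` at time `T`, so its extension by zero has no jump
  -- there and is a primitive of `D` on the whole half-line.
  have hprim : ∀ b ∈ Ici (0 : ℝ), (Icc 0 T).indicator (fun r => d.val (T - r)) b =
      d.val T + ∫ r in (0 : ℝ)..b, D r := by
    intro b hb
    rcases le_total b T with h | h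
    · rw [hle b hb h, indicator_of_mem (show b ∈ Icc 0 T from ⟨hb, h⟩)]
      abel
    · rw [← intervalIntegral.integral_add_adjacent_intervals (b := T)
        hDint.intervalIntegrable hDint.intervalIntegrable, hgt b h, hle T hT le_rfl, sub_self, hd]
      rcases h.eq_or_lt with rfl | h'
      · simp [hT, hd]
      · rw [indicator_of_notMem fun h => absurd h.2 (not_le.2 h')]
        simp
  refine ⟨{ val := (Icc 0 T).indicator fun r => d.val (T - r)
            deriv := D
            lift := (Icc 0 T).indicator fun r => d.lift (T - r)
            memLp_val := memLp_reverse d.memLp_val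
            memLp_deriv := memLp_reverse d.memLp_deriv.neg
            memLp_lift := memLp_reverse d.memLp_lift
            lift_eq := ?_
            sub_eq_integral := ?_ }, ?_, ?_⟩
  · have := (ae_restrict_iff' measurableSet_Icc).1 (hmp.quasiMeasurePreserving.ae d.lift_eq)
    filter_upwards [ae_restrict_of_ae this] with r hr
    by_cases h : r ∈ Icc 0 T
    · simpa only [indicator_of_mem h] using hr h
    · simp [indicator_of_notMem h]
  · intro a ha b hb
    refine ⟨hDint.intervalIntegrable, ?_⟩
    rw [hprim a ha, hprim b hb, ← intervalIntegral.integral_add_adjacent_intervals (a := 0) (b := a)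
      (c := b) hDint.intervalIntegrable hDint.intervalIntegrable]
    abel
  · intro s hs
    have : T - s ∈ Icc 0 T := ⟨by linarith [hs.2], by linarith [hs.1]⟩
    simp [indicator_of_mem this]
  · refine le_of_eq ?_
    have h := lpNormOn_reverse d.memLp_deriv.neg
    rw [lpNormOn_neg] at h
    simp only [norm_eq]
    rw [lpNormOn_reverse d.memLp_val, lpNormOn_reverse d.memLp_lift, ← h]
    rfl

theorem lift_ae_eq (hj : Function.Injective j) (hI : MeasurableSet I) {u v : MRSpace j p I}
    (h : EqOn u.val v.val I) : u.lift =ᵐ[volume.restrict I] v.lift := by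
  filter_upwards [u.lift_eq, v.lift_eq, ae_restrict_mem hI] with t hu hv ht
  exact hj (by rw [hu, hv, h ht])

/-- Agreement of the derivatives is a hypothesis because the functions to be compared solve the same
equation, from which it can be read off once the lifts agree. -/
theorem norm_congr (hj : Function.Injective j) (hI : MeasurableSet I) {u v : MRSpace j p I}
    (h : EqOn u.val v.val I) (h' : u.deriv =ᵐ[volume.restrict I] v.deriv) : u.norm = v.norm := by
  rw [norm_eq, norm_eq, lpNormOn_congr_ae h', lpNormOn_congr_ae (lift_ae_eq hj hI h),
    lpNormOn_congr_ae ((ae_restrict_mem hI).mono fun t ht => h ht)]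

/-- A vanishing norm makes the derivative zero almost everywhere, and `d` is the primitive of its
derivative starting from zero. -/
theorem val_eq_zero_of_norm_eq_zero (hp : 1 ≤ p) {T : ℝ} (d : MRSpace j p (Icc 0 T))
    (hd : d.val 0 = 0) (h : d.norm = 0) {t : ℝ} (ht : t ∈ Icc 0 T) : d.val t = 0 := by
  have h1 : lpNormOn d.deriv p (Icc 0 T) = 0 :=
    le_antisymm (d.lpNormOn_deriv_le.trans h.le) (lpNormOn_nonneg _ _ _)
  rw [lpNormOn, ENNReal.toReal_eq_zero_iff, or_iff_left d.memLp_deriv.2.ne,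
    eLpNorm_eq_zero_iff d.memLp_deriv.1 (by positivity)] at h1
  have h2 := (d.sub_eq_integral 0 ⟨le_rfl, ht.1.trans ht.2⟩ t ht).2
  rw [hd, sub_zero] at h2
  rw [h2]
  refine (intervalIntegral.integral_congr_ae (g := 0) ?_).trans (by simp)
  rw [EventuallyEq, ae_restrict_iff' measurableSet_Icc] at h1
  filter_upwards [h1] with r hr hr'
  rw [uIoc_of_le ht.1] at hr'
  exact hr ⟨hr'.1.le, hr'.2.trans ht.2⟩

end MRSpace

end MaximalRegularitySpace

/-! ### The trace space and the embedding of MR into continuous `X_p`-valued functions. -/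

section TraceSpace

variable {X₀ X₁ : Type*} [NormedAddCommGroup X₀] [NormedSpace ℝ X₀]
  [NormedAddCommGroup X₁] [NormedSpace ℝ X₁] {j : X₁ →L[ℝ] X₀} {p : ℝ≥0∞}

theorem traceNorm_nonneg (x : X₀) : 0 ≤ traceNorm j p x :=
  Real.iInf_nonneg fun u => u.1.norm_nonneg

theorem traceNorm_val_zero_le (w : MRSpace j p (Ici 0)) : traceNorm j p (w.val 0) ≤ w.norm :=
  ciInf_le (f := fun u : {u : MRSpace j p (Ici 0) // u.val 0 = w.val 0} => u.1.norm)
    ⟨0, by rintro _ ⟨u, rfl⟩; exact u.1.norm_nonneg⟩ ⟨w, rfl⟩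

/-- Membership in the trace space is essential: otherwise the infimum runs over an empty type and
has the default value `0`, which no function realises. -/
theorem exists_norm_lt_of_traceNorm_lt {x : X₀} (hx : x ∈ traceSpace j p) {c : ℝ}
    (hc : traceNorm j p x < c) : ∃ w : MRSpace j p (Ici 0), w.val 0 = x ∧ w.norm < c := by
  obtain ⟨w, hw⟩ := hx
  have : Nonempty {u : MRSpace j p (Ici 0) // u.val 0 = x} := ⟨⟨w, hw⟩⟩
  obtain ⟨u, hu⟩ := exists_lt_of_ciInf_lt hc
  exact ⟨u.1, u.2, hu⟩

theorem zero_mem_traceSpace : (0 : X₀) ∈ traceSpace j p := ⟨0, rfl⟩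

theorem traceNorm_zero : traceNorm j p (0 : X₀) = 0 := by
  refine le_antisymm ?_ (traceNorm_nonneg _)
  have h := traceNorm_val_zero_le (0 : MRSpace j p (Ici 0))
  rwa [MRSpace.norm_zero] at h

theorem neg_mem_traceSpace {x : X₀} (hx : x ∈ traceSpace j p) : -x ∈ traceSpace j p := by
  obtain ⟨w, rfl⟩ := hx
  exact ⟨-w, rfl⟩

theorem add_mem_traceSpace {x y : X₀} (hx : x ∈ traceSpace j p) (hy : y ∈ traceSpace j p) :
    x + y ∈ traceSpace j p := by
  obtain ⟨w, rfl⟩ := hx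
  obtain ⟨v, rfl⟩ := hy
  exact ⟨w + v, rfl⟩

theorem sub_mem_traceSpace {x y : X₀} (hx : x ∈ traceSpace j p) (hy : y ∈ traceSpace j p) :
    x - y ∈ traceSpace j p := by
  obtain ⟨w, rfl⟩ := hx
  obtain ⟨v, rfl⟩ := hy
  exact ⟨w - v, rfl⟩

theorem traceNorm_add_le (hp : 1 ≤ p) {x y : X₀} (hx : x ∈ traceSpace j p)
    (hy : y ∈ traceSpace j p) :
    traceNorm j p (x + y) ≤ traceNorm j p x + traceNorm j p y := by
  refine le_of_forall_pos_le_add fun η hη => ?_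
  obtain ⟨w, rfl, hw⟩ := exists_norm_lt_of_traceNorm_lt hx
    (show traceNorm j p x < traceNorm j p x + η / 2 by linarith)
  obtain ⟨v, rfl, hv⟩ := exists_norm_lt_of_traceNorm_lt hy
    (show traceNorm j p y < traceNorm j p y + η / 2 by linarith)
  have := traceNorm_val_zero_le (w + v)
  simp only [MRSpace.add_val, Pi.add_apply] at this
  linarith [MRSpace.norm_add_le hp w v]

theorem traceNorm_neg_le {x : X₀} (hx : x ∈ traceSpace j p) :
    traceNorm j p (-x) ≤ traceNorm j p x := by
  refine le_of_forall_pos_le_add fun η hη => ?_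
  obtain ⟨w, rfl, hw⟩ := exists_norm_lt_of_traceNorm_lt hx
    (show traceNorm j p x < traceNorm j p x + η by linarith)
  have := traceNorm_val_zero_le (-w)
  rw [MRSpace.norm_neg] at this
  exact this.trans hw.le

theorem traceNorm_sub_comm {x y : X₀} (hx : x ∈ traceSpace j p) (hy : y ∈ traceSpace j p) :
    traceNorm j p (x - y) = traceNorm j p (y - x) := by
  apply le_antisymm
  · simpa using traceNorm_neg_le (sub_mem_traceSpace hy hx)
  · simpa using traceNorm_neg_le (sub_mem_traceSpace hx hy)

theorem traceNorm_le_sub_add (hp : 1 ≤ p) {x y : X₀} (hx : x ∈ traceSpace j p)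
    (hy : y ∈ traceSpace j p) :
    traceNorm j p x ≤ traceNorm j p (x - y) + traceNorm j p y := by
  simpa using traceNorm_add_le hp (sub_mem_traceSpace hx hy) hy

namespace MRSpace

/-- The left translate of `w` by `t` is again a function on the half-line, and its initial value is
`w(t)`. The norm bound and the continuity in `X_p` below have the same source. -/
theorem val_mem_traceSpace (w : MRSpace j p (Ici 0)) {t : ℝ} (ht : 0 ≤ t) :
    w.val t ∈ traceSpace j p :=
  ⟨w.translate ht, by simp⟩

theorem traceNorm_val_le (w : MRSpace j p (Ici 0)) {t : ℝ} (ht : 0 ≤ t) :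
    traceNorm j p (w.val t) ≤ w.norm := by
  have h := traceNorm_val_zero_le (w.translate ht)
  simp only [translate_val, add_zero] at h
  exact h.trans (w.norm_translate_le ht)

theorem tendsto_traceNorm_val_sub (hp : 1 ≤ p) (hp' : p ≠ ∞) (w : MRSpace j p (Ici 0)) {s : ℝ}
    (hs : 0 ≤ s) :
    Tendsto (fun t => traceNorm j p (w.val t - w.val s)) (𝓝[Ici 0] s) (𝓝 0) := by
  have h := ((tendsto_lpNormOn_translate hp hp' w.memLp_val hs).add
    (tendsto_lpNormOn_translate hp hp' w.memLp_deriv hs)).add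
    (tendsto_lpNormOn_translate hp hp' w.memLp_lift hs)
  simp only [add_zero] at h
  refine squeeze_zero' (Eventually.of_forall fun _ => traceNorm_nonneg _) ?_ h
  filter_upwards [self_mem_nhdsWithin] with t ht
  have := traceNorm_val_zero_le (w.translate (mem_Ici.1 ht) - w.translate hs)
  simpa only [norm_eq, sub_val, sub_deriv, sub_lift, translate_val, translate_deriv,
    translate_lift, Pi.sub_apply, add_zero] using this

section Interval

variable {T : ℝ}

/-- In general, extending a function from `[0, T]` to the half-line costs a constant depending on
`T`. For functions vanishing at zero, reversal and extension by zero cost nothing, and `d(t)` is the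
value of the extension at `T - t`. -/
theorem val_mem_traceSpace_of_val_zero (d : MRSpace j p (Icc 0 T)) (hd : d.val 0 = 0) {t : ℝ}
    (ht : t ∈ Icc 0 T) : d.val t ∈ traceSpace j p := by
  obtain ⟨w, hw, -⟩ := exists_reverse (ht.1.trans ht.2) d hd
  rw [← hw t ht]
  exact w.val_mem_traceSpace (by linarith [ht.2])

/-- The embedding into `C([0, T]; X_p)` has norm at most one on functions vanishing at zero. -/
theorem traceNorm_val_le_of_val_zero (d : MRSpace j p (Icc 0 T)) (hd : d.val 0 = 0) {t : ℝ}
    (ht : t ∈ Icc 0 T) : traceNorm j p (d.val t) ≤ d.norm := by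
  obtain ⟨w, hw, hwn⟩ := exists_reverse (ht.1.trans ht.2) d hd
  rw [← hw t ht]
  exact (w.traceNorm_val_le (by linarith [ht.2])).trans hwn

theorem val_mem_traceSpace_of_val_zero_mem (u : MRSpace j p (Icc 0 T))
    (hu : u.val 0 ∈ traceSpace j p) {t : ℝ} (ht : t ∈ Icc 0 T) : u.val t ∈ traceSpace j p := by
  obtain ⟨w, hw⟩ := hu
  have h := (u - w.restrict Icc_subset_Ici_self).val_mem_traceSpace_of_val_zero
    (by simp [hw]) ht
  simpa using add_mem_traceSpace h (w.val_mem_traceSpace ht.1)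

/-- Subtracting a nearly optimal half-line function `w` with the same initial value leaves a
function vanishing at zero. The factor `2` arises because `w` is counted once in the norm of `u - w`
and once for its own values. -/
theorem traceNorm_val_le_add (hp : 1 ≤ p) (u : MRSpace j p (Icc 0 T))
    (hu : u.val 0 ∈ traceSpace j p) {t : ℝ} (ht : t ∈ Icc 0 T) :
    traceNorm j p (u.val t) ≤ u.norm + 2 * traceNorm j p (u.val 0) := by
  refine le_of_forall_pos_le_add fun η hη => ?_
  obtain ⟨w, hw, hwn⟩ := exists_norm_lt_of_traceNorm_lt hu
    (show traceNorm j p (u.val 0) < traceNorm j p (u.val 0) + η / 2 by linarith)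
  have h0 : (u - w.restrict Icc_subset_Ici_self).val 0 = 0 := by simp [hw]
  have h := traceNorm_val_le_of_val_zero _ h0 ht
  have h' := traceNorm_le_sub_add hp (u.val_mem_traceSpace_of_val_zero_mem hu ht)
    (w.val_mem_traceSpace ht.1)
  simp only [sub_val, restrict_val, Pi.sub_apply] at h
  linarith [w.traceNorm_val_le ht.1, norm_sub_le hp u (w.restrict Icc_subset_Ici_self),
    w.norm_restrict_le (I := Icc 0 T) Icc_subset_Ici_self]

/-- On `[0, T]`, `u` is the sum of a half-line function and of a time-reversed half-line function,
and both are continuous into `X_p`. -/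
theorem tendsto_traceNorm_val_sub_Icc (hp : 1 ≤ p) (hp' : p ≠ ∞) (u : MRSpace j p (Icc 0 T))
    (hu : u.val 0 ∈ traceSpace j p) {s : ℝ} (hs : s ∈ Icc 0 T) :
    Tendsto (fun t => traceNorm j p (u.val t - u.val s)) (𝓝[Icc 0 T] s) (𝓝 0) := by
  obtain ⟨w, hw⟩ := id hu
  have hd0 : (u - w.restrict Icc_subset_Ici_self).val 0 = 0 := by simp [hw]
  obtain ⟨v, hv, -⟩ := exists_reverse (hs.1.trans hs.2) _ hd0
  simp only [sub_val, restrict_val, Pi.sub_apply] at hv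
  have h1 := (w.tendsto_traceNorm_val_sub hp hp' hs.1).mono_left
    (nhdsWithin_mono s (s := Icc 0 T) Icc_subset_Ici_self)
  have h2 : Tendsto (fun t => T - t) (𝓝[Icc 0 T] s) (𝓝[Ici 0] (T - s)) := by
    refine tendsto_nhdsWithin_of_tendsto_nhds_of_eventually_within _ ?_ ?_
    · exact (Continuous.tendsto (by fun_prop) s).mono_left nhdsWithin_le_nhds
    · filter_upwards [self_mem_nhdsWithin] with t ht
      exact sub_nonneg.2 ht.2
  have h3 := (v.tendsto_traceNorm_val_sub hp hp' (sub_nonneg.2 hs.2)).comp h2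
  have h4 := h1.add h3
  rw [add_zero] at h4
  refine squeeze_zero' (Eventually.of_forall fun _ => traceNorm_nonneg _) ?_ h4
  filter_upwards [self_mem_nhdsWithin] with t ht
  have h5 := traceNorm_add_le hp (sub_mem_traceSpace (w.val_mem_traceSpace ht.1)
    (w.val_mem_traceSpace hs.1)) (sub_mem_traceSpace
    (v.val_mem_traceSpace (sub_nonneg.2 ht.2)) (v.val_mem_traceSpace (sub_nonneg.2 hs.2)))
  have h6 : u.val t - u.val s =
      w.val t - w.val s + (v.val (T - t) - v.val (T - s)) := by
    rw [hv t ht, hv s hs]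
    abel
  rw [h6]
  exact h5

end Interval

end MRSpace

end TraceSpace

/-! ### Linear maximal regularity with constants independent of the interval. -/

section LinearTheory

variable {X₀ X₁ : Type*} [NormedAddCommGroup X₀] [NormedSpace ℝ X₀]
  [NormedAddCommGroup X₁] [NormedSpace ℝ X₁] {j : X₁ →L[ℝ] X₀} {p : ℝ≥0∞} {I : Set ℝ}
  {B : ℝ → X₁ →L[ℝ] X₀} {T₀ τ M K : ℝ}

theorem aestronglyMeasurable_clm_apply {B : ℝ → X₁ →L[ℝ] X₀} {l : ℝ → X₁} {μ : Measure ℝ}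
    (hB : ∀ y, AEStronglyMeasurable (fun t => B t y) μ) (hl : AEStronglyMeasurable l μ) :
    AEStronglyMeasurable (fun t => B t (l t)) μ :=
  aestronglyMeasurable_caratheodory (H := fun y t => B t y) hB
    (Eventually.of_forall fun t => (B t).continuous) hl

namespace MRSpace

/-- The right-hand side `u' + B u` of the linear equation satisfied by `u`. -/
def residual (B : ℝ → X₁ →L[ℝ] X₀) (u : MRSpace j p I) (t : ℝ) : X₀ :=
  u.deriv t + B t (u.lift t)

theorem residual_sub (u v : MRSpace j p I) :
    (u - v).residual B = u.residual B - v.residual B := by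
  funext t
  simp only [residual, sub_deriv, sub_lift, Pi.sub_apply, map_sub]
  abel

end MRSpace

/-- Maximal `L^p`-regularity on all intervals `(0, τ)`, `τ ≤ T₀`, with a common constant `K`, of a
bounded strongly measurable family of operators. -/
structure IsUniformlyMaximallyRegular (j : X₁ →L[ℝ] X₀) (p : ℝ≥0∞) (T₀ : ℝ)
    (B : ℝ → X₁ →L[ℝ] X₀) (M K : ℝ) : Prop where
  M_nonneg : 0 ≤ M
  K_nonneg : 0 ≤ K
  aestronglyMeasurable : ∀ y, AEStronglyMeasurable (fun t => B t y) (volume.restrict (Icc 0 T₀))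
  norm_le : ∀ t ∈ Icc 0 T₀, ∀ y, ‖B t y‖ ≤ M * ‖y‖
  estimate : ∀ τ, 0 < τ → τ ≤ T₀ → ∀ u : MRSpace j p (Icc 0 τ), u.val 0 = 0 →
    MemLp (u.residual B) p (volume.restrict (Icc 0 τ)) →
    u.norm ≤ K * lpNormOn (u.residual B) p (Icc 0 τ)
  exists_solution : ∀ τ, 0 < τ → τ ≤ T₀ → ∀ f, MemLp f p (volume.restrict (Icc 0 τ)) →
    ∃ u : MRSpace j p (Icc 0 τ), IsLinearSolution B f 0 u

/-- Maximal regularity on `(0, T₀)` together with uniqueness of strong solutions on the smaller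
intervals `(0, τ)` yields maximal regularity with a constant independent of `τ`. -/
theorem exists_isUniformlyMaximallyRegular (hj : Function.Injective j) (hp : 1 ≤ p)
    (hT₀ : 0 < T₀)
    (hmeas : ∀ y, AEStronglyMeasurable (fun t => B t y) (volume.restrict (Icc 0 T₀)))
    (hbdd : ∃ M : ℝ, ∀ t ∈ Icc 0 T₀, ∀ y, ‖B t y‖ ≤ M * ‖y‖)
    (hB : ∀ τ, 0 < τ → τ ≤ T₀ → HasMaximalRegularity j p 0 τ B) :
    ∃ M K, IsUniformlyMaximallyRegular j p T₀ B M K := by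
  obtain ⟨M, hM⟩ := hbdd
  obtain ⟨K, hK⟩ := hB T₀ hT₀ le_rfl
  refine ⟨|M|, |K|, abs_nonneg _, abs_nonneg _, hmeas, fun t ht y => (hM t ht y).trans
    (by gcongr; exact le_abs_self M), ?_, ?_⟩
  · intro τ hτ hτT u hu hf
    set f := u.residual B with hfdef
    have hsub : Icc 0 τ ⊆ Icc 0 T₀ := Icc_subset_Icc le_rfl hτT
    -- Extending `f` by zero to `(0, T₀)` makes the constant `K` of the largest interval available
    -- on `(0, τ)`.
    have hg : MemLp ((Icc 0 τ).indicator f) p (volume.restrict (Icc 0 T₀)) := by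
      rw [memLp_indicator_iff_restrict measurableSet_Icc,
        Measure.restrict_restrict measurableSet_Icc, inter_eq_left.2 hsub]
      exact hf
    obtain ⟨v, ⟨hv0, hv⟩, hvn, -⟩ := hK _ hg
    obtain ⟨_, H⟩ := hB τ hτ hτT
    obtain ⟨u', -, -, huniq⟩ := H f hf
    have hv' : ∀ᵐ t ∂(volume.restrict (Icc 0 τ)), v.deriv t + B t (v.lift t) = f t := by
      filter_upwards [ae_restrict_of_ae_restrict_of_subset hsub hv,
        ae_restrict_mem measurableSet_Icc] with t ht htm
      rw [ht, indicator_of_mem htm]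
    -- Both `u` and the restriction of `v` are strong solutions on `(0, τ)` with right-hand side
    -- `f`, so uniqueness there identifies them.
    have h1 : EqOn u.val u'.val (Icc 0 τ) :=
      huniq (u.toOne hp) ⟨hu, Eventually.of_forall fun t => rfl⟩
    have h2 : EqOn v.val u'.val (Icc 0 τ) := huniq ((v.restrict hsub).toOne hp) ⟨hv0, hv'⟩
    have h3 : EqOn u.val (v.restrict hsub).val (Icc 0 τ) := fun t ht => (h1 ht).trans (h2 ht).symm
    have h4 : u.deriv =ᵐ[volume.restrict (Icc 0 τ)] (v.restrict hsub).deriv := by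
      filter_upwards [MRSpace.lift_ae_eq hj measurableSet_Icc h3, hv'] with t h5 h6
      have h7 : u.deriv t + B t (u.lift t) = v.deriv t + B t (v.lift t) := by rw [h6]; rfl
      rw [h5] at h7
      exact add_right_cancel h7
    rw [MRSpace.norm_congr hj measurableSet_Icc h3 h4]
    refine (v.norm_restrict_le hsub).trans (hvn.trans ?_)
    change K * lpNormOn _ p _ ≤ _
    rw [lpNormOn_indicator measurableSet_Icc hsub]
    exact mul_le_mul_of_nonneg_right (le_abs_self K) (lpNormOn_nonneg _ _ _)
  · intro τ hτ hτT f hf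
    obtain ⟨_, H⟩ := hB τ hτ hτT
    obtain ⟨u, hu, -, -⟩ := H f hf
    exact ⟨u, hu⟩

namespace IsUniformlyMaximallyRegular

variable (h : IsUniformlyMaximallyRegular j p T₀ B M K)
include h

theorem ae_norm_le (hτT : τ ≤ T₀) :
    ∀ᵐ t ∂(volume.restrict (Icc 0 τ)), ∀ y, ‖B t y‖ ≤ M * ‖y‖ := by
  filter_upwards [ae_restrict_mem measurableSet_Icc] with t ht
  exact h.norm_le t ⟨ht.1, ht.2.trans hτT⟩

theorem memLp_apply (hτT : τ ≤ T₀) {l : ℝ → X₁} (hl : MemLp l p (volume.restrict (Icc 0 τ))) :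
    MemLp (fun t => B t (l t)) p (volume.restrict (Icc 0 τ)) := by
  refine hl.of_le_mul (c := M) (aestronglyMeasurable_clm_apply (fun y => ?_) hl.1) ?_
  · exact (h.aestronglyMeasurable y).mono_measure
      (Measure.restrict_mono (Icc_subset_Icc le_rfl hτT) le_rfl)
  · filter_upwards [h.ae_norm_le hτT] with t ht using ht _

theorem memLp_residual (hτT : τ ≤ T₀) (u : MRSpace j p (Icc 0 τ)) :
    MemLp (u.residual B) p (volume.restrict (Icc 0 τ)) :=
  u.memLp_deriv.add (h.memLp_apply hτT u.memLp_lift)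

theorem lpNormOn_residual_le (hp : 1 ≤ p) (hτT : τ ≤ T₀) (u : MRSpace j p (Icc 0 τ)) :
    lpNormOn (u.residual B) p (Icc 0 τ) ≤ (1 + M) * u.norm := by
  have h1 : lpNormOn (u.residual B) p (Icc 0 τ) ≤
      1 * lpNormOn u.deriv p (Icc 0 τ) + M * lpNormOn u.lift p (Icc 0 τ) := by
    refine lpNormOn_le_of_le_add hp zero_le_one h.M_nonneg u.memLp_deriv u.memLp_lift ?_
    filter_upwards [h.ae_norm_le hτT] with t ht
    rw [one_mul]
    exact (_root_.norm_add_le _ _).trans (by gcongr; exact ht _)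
  have h2 := mul_le_mul_of_nonneg_left u.lpNormOn_lift_le h.M_nonneg
  linarith [u.lpNormOn_deriv_le]

/-- Take `w` plus the solution with zero initial value for the right-hand side `f - (w' + Bw)`,
which lies in `L^p` since `B` is bounded. -/
theorem exists_solution_of_val_zero (hτ : 0 < τ) (hτT : τ ≤ T₀) (w : MRSpace j p (Icc 0 τ))
    {f : ℝ → X₀} (hf : MemLp f p (volume.restrict (Icc 0 τ))) :
    ∃ u : MRSpace j p (Icc 0 τ), IsLinearSolution B f (w.val 0) u := by
  obtain ⟨u, hu0, hu⟩ := h.exists_solution τ hτ hτT _ (hf.sub (h.memLp_residual hτT w))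
  refine ⟨u + w, by simp [hu0], ?_⟩
  filter_upwards [hu] with t ht
  simp only [Pi.sub_apply, MRSpace.residual] at ht
  simp only [MRSpace.add_deriv, MRSpace.add_lift, Pi.add_apply, map_add]
  rw [← sub_eq_zero] at ht ⊢
  rw [← ht]
  abel

/-- The a priori estimate for solutions with the initial value of `w`. -/
theorem norm_sub_le (hp : 1 ≤ p) (hτ : 0 < τ) (hτT : τ ≤ T₀) (u w : MRSpace j p (Icc 0 τ))
    (huw : u.val 0 = w.val 0) :
    (u - w).norm ≤ K * (lpNormOn (u.residual B) p (Icc 0 τ) + (1 + M) * w.norm) := by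
  have h1 := h.estimate τ hτ hτT (u - w) (by simp [huw]) (h.memLp_residual hτT _)
  refine h1.trans (mul_le_mul_of_nonneg_left ?_ h.K_nonneg)
  rw [MRSpace.residual_sub, sub_eq_add_neg]
  have h2 := lpNormOn_add_le hp (h.memLp_residual hτT u) (h.memLp_residual hτT w).neg
  rw [lpNormOn_neg] at h2
  linarith [h.lpNormOn_residual_le hp hτT w]

end IsUniformlyMaximallyRegular

end LinearTheory

/-! ### The quasilinear problem as a perturbation of the linear one. -/

section QuasilinearProblem

variable {X₀ X₁ : Type*} [NormedAddCommGroup X₀] [NormedSpace ℝ X₀]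
  [NormedAddCommGroup X₁] [NormedSpace ℝ X₁] {j : X₁ →L[ℝ] X₀} {p : ℝ≥0∞} {T₀ T M K : ℝ}

theorem MRSpace.norm_le_sub_add {I : Set ℝ} (hp : 1 ≤ p) (u w : MRSpace j p I) :
    u.norm ≤ (u - w).norm + w.norm := by
  refine le_trans (le_of_eq ?_) (norm_add_le hp (u - w) w)
  simp [MRSpace.norm_eq]

/-- A contraction argument in a ball of `L^p(0, T; X₀)`, applied to the right-hand side of the
linear equation. -/
theorem exists_isLinearSolution_self [CompleteSpace X₀] (hp : 1 ≤ p) {B : ℝ → X₁ →L[ℝ] X₀}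
    {x : X₀} {r : ℝ} (hr : 0 ≤ r) {N : MRSpace j p (Icc 0 T) → ℝ → X₀}
    (hsol : ∀ g, MemLp g p (volume.restrict (Icc 0 T)) →
      ∃ v : MRSpace j p (Icc 0 T), IsLinearSolution B g x v)
    (hN : ∀ v, v.val 0 = x → MemLp (N v) p (volume.restrict (Icc 0 T)))
    (hball : ∀ g v, MemLp g p (volume.restrict (Icc 0 T)) → lpNormOn g p (Icc 0 T) ≤ r →
      IsLinearSolution B g x v → lpNormOn (N v) p (Icc 0 T) ≤ r)
    (hcontr : ∀ g₁ g₂ v₁ v₂, MemLp g₁ p (volume.restrict (Icc 0 T)) →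
      MemLp g₂ p (volume.restrict (Icc 0 T)) → lpNormOn g₁ p (Icc 0 T) ≤ r →
      lpNormOn g₂ p (Icc 0 T) ≤ r → IsLinearSolution B g₁ x v₁ → IsLinearSolution B g₂ x v₂ →
      lpNormOn (N v₁ - N v₂) p (Icc 0 T) ≤ 1 / 2 * lpNormOn (g₁ - g₂) p (Icc 0 T)) :
    ∃ (g : ℝ → X₀) (v : MRSpace j p (Icc 0 T)), MemLp g p (volume.restrict (Icc 0 T)) ∧
      lpNormOn g p (Icc 0 T) ≤ r ∧ IsLinearSolution B g x v ∧
      N v =ᵐ[volume.restrict (Icc 0 T)] g := by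
  have : Fact (1 ≤ p) := ⟨hp⟩
  let Y := Metric.closedBall (0 : Lp X₀ p (volume.restrict (Icc 0 T))) r
  have : CompleteSpace Y := Metric.isClosed_closedBall.completeSpace_coe
  have : Nonempty Y := ⟨⟨0, Metric.mem_closedBall_self hr⟩⟩
  have hY : ∀ g : Y, lpNormOn g.1 p (Icc 0 T) ≤ r := by
    intro g
    have := mem_closedBall_zero_iff.1 g.2
    rwa [Lp.norm_def] at this
  -- The choice of solution is harmless: the ball and contraction hypotheses hold for every linear
  -- solution.
  choose v hv using fun g : Y => hsol g.1 (Lp.memLp g.1)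
  let Φ : Y → Y := fun g => ⟨(hN (v g) (hv g).1).toLp, by
    rw [mem_closedBall_zero_iff, Lp.norm_toLp]
    exact hball g.1 (v g) (Lp.memLp g.1) (hY g) (hv g)⟩
  have hΦ : ContractingWith (1 / 2) Φ := by
    refine ⟨by norm_num, LipschitzWith.of_dist_le_mul fun g₁ g₂ => ?_⟩
    have h := hcontr g₁.1 g₂.1 (v g₁) (v g₂) (Lp.memLp _) (Lp.memLp _) (hY g₁) (hY g₂)
      (hv g₁) (hv g₂)
    rw [Subtype.dist_eq, Subtype.dist_eq, dist_eq_norm, dist_eq_norm, ← MemLp.toLp_sub,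
      Lp.norm_toLp, Lp.norm_def]
    rw [← lpNormOn_congr_ae (Lp.coeFn_sub g₁.1 g₂.1)] at h
    exact_mod_cast h
  have hfix : Φ (hΦ.fixedPoint Φ) = hΦ.fixedPoint Φ := hΦ.fixedPoint_isFixedPt
  set g := hΦ.fixedPoint Φ
  refine ⟨g.1, v g, Lp.memLp _, hY g, hv g, ?_⟩
  have h1 : (hN (v g) (hv g).1).toLp = g.1 := congrArg Subtype.val hfix
  rw [← h1]
  exact (MemLp.coeFn_toLp _).symm

/-- Superposition of a Carathéodory-Lipschitz function on the trace space with a function of the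
maximal regularity space. -/
theorem MRSpace.aestronglyMeasurable_comp_val {E : Type*} [NormedAddCommGroup E] (hp : 1 ≤ p)
    (hp' : p ≠ ∞) (hT : 0 ≤ T) (v : MRSpace j p (Icc 0 T)) (hv : v.val 0 ∈ traceSpace j p)
    {G : ℝ → X₀ → E} {ψ : ℝ → ℝ}
    (hG : ∀ x ∈ traceSpace j p,
      AEStronglyMeasurable (fun t => G t x) (volume.restrict (Icc 0 T)))
    (hψ : ∀ᵐ t ∂(volume.restrict (Icc 0 T)), ∀ s ∈ Icc 0 T, ∀ s' ∈ Icc 0 T,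
      ‖G t (v.val s) - G t (v.val s')‖ ≤ ψ t * traceNorm j p (v.val s - v.val s')) :
    AEStronglyMeasurable (fun t => G t (v.val t)) (volume.restrict (Icc 0 T)) := by
  -- The Carathéodory lemma is applied with time, not `X_p`, as parameter space: `G(t, v(c(s)))` is
  -- measurable in `t`, continuous in `s`, and is evaluated at `s = t`. The projection makes it
  -- defined for all real `s`.
  let c : ℝ → ℝ := fun s => projIcc 0 T hT s
  have hc : ∀ s, c s ∈ Icc 0 T := fun s => (projIcc 0 T hT s).2
  have hcc : Continuous c := continuous_subtype_val.comp continuous_projIcc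
  have h := aestronglyMeasurable_caratheodory (H := fun s t => G t (v.val (c s)))
    (fun s => hG _ (v.val_mem_traceSpace_of_val_zero_mem hv (hc s))) (κ := fun s : ℝ => s)
    (μ := volume.restrict (Icc 0 T)) ?_ aestronglyMeasurable_id
  · refine h.congr ?_
    filter_upwards [ae_restrict_mem measurableSet_Icc] with t ht
    simp only [c, projIcc_of_mem hT ht]
  · filter_upwards [hψ] with t ht
    refine continuous_iff_continuousAt.2 fun s => ?_
    refine tendsto_iff_norm_sub_tendsto_zero.2 ?_
    have h1 : Tendsto c (𝓝 s) (𝓝[Icc 0 T] (c s)) :=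
      tendsto_nhdsWithin_of_tendsto_nhds_of_eventually_within _ (hcc.tendsto s)
        (Eventually.of_forall hc)
    have h2 := ((v.tendsto_traceNorm_val_sub_Icc hp hp' hv (hc s)).comp h1).const_mul (ψ t)
    rw [mul_zero] at h2
    exact squeeze_zero (fun _ => _root_.norm_nonneg _) (fun s' => ht _ (hc s') _ (hc s)) h2

/-- Strong measurability, local Lipschitz continuity and integrability of the coefficients of a
quasilinear problem. -/
structure QuasilinearCoefficients (j : X₁ →L[ℝ] X₀) (p : ℝ≥0∞) (T₀ : ℝ)
    (A : ℝ → X₀ → X₁ →L[ℝ] X₀) (F : ℝ → X₀ → X₀) : Prop where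
  A_meas : ∀ x ∈ traceSpace j p, ∀ y : X₁,
    AEStronglyMeasurable (fun t => A t x y) (volume.restrict (Icc 0 T₀))
  A_lip : ∀ R : ℝ, 0 < R → ∃ C : ℝ, 0 < C ∧ ∀ t ∈ Icc 0 T₀,
    ∀ x₁ ∈ traceSpace j p, ∀ x₂ ∈ traceSpace j p, traceNorm j p x₁ ≤ R → traceNorm j p x₂ ≤ R →
      ∀ y : X₁, ‖A t x₁ y - A t x₂ y‖ ≤ C * traceNorm j p (x₁ - x₂) * ‖y‖
  F_meas : ∀ x ∈ traceSpace j p,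
    AEStronglyMeasurable (fun t => F t x) (volume.restrict (Icc 0 T₀))
  F_zero : MemLp (fun t => F t 0) p (volume.restrict (Icc 0 T₀))
  F_lip : ∀ R : ℝ, 0 < R → ∃ φ : ℝ → ℝ, MemLp φ p (volume.restrict (Icc 0 T₀)) ∧
    ∀ᵐ t ∂(volume.restrict (Icc 0 T₀)),
      ∀ x₁ ∈ traceSpace j p, ∀ x₂ ∈ traceSpace j p,
        traceNorm j p x₁ ≤ R → traceNorm j p x₂ ≤ R →
          ‖F t x₁ - F t x₂‖ ≤ φ t * traceNorm j p (x₁ - x₂)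

variable {A : ℝ → X₀ → X₁ →L[ℝ] X₀} {F : ℝ → X₀ → X₀} {x₀ : X₀}

/-- The right-hand side `(A(t, x₀) - A(t, v)) v + F(t, v)` of the quasilinear problem, written as a
perturbation of the linear problem for `A(t, x₀)`. -/
def MRSpace.perturbation {I : Set ℝ} (A : ℝ → X₀ → X₁ →L[ℝ] X₀) (F : ℝ → X₀ → X₀) (x₀ : X₀)
    (v : MRSpace j p I) (t : ℝ) : X₀ :=
  A t x₀ (v.lift t) - A t (v.val t) (v.lift t) + F t (v.val t)

theorem isQuasilinearSolution_iff {x : X₀} {u : MRSpace j p (Icc 0 T)} :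
    IsQuasilinearSolution A F x u ↔
      IsLinearSolution (fun t => A t x₀) (u.perturbation A F x₀) x u := by
  refine and_congr_right fun _ => eventually_congr (Eventually.of_forall fun t => ?_)
  simp only [MRSpace.perturbation]
  constructor <;> intro h
  · rw [← h]; abel
  · rw [← sub_eq_zero] at h ⊢
    rw [← h]; abel

namespace QuasilinearCoefficients

theorem memLp_F (D : QuasilinearCoefficients j p T₀ A F) {x : X₀}
    (hx : x ∈ traceSpace j p) :
    MemLp (fun t => F t x) p (volume.restrict (Icc 0 T₀)) := by
  obtain ⟨φ, hφ, hF⟩ := D.F_lip (traceNorm j p x + 1)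
    (by linarith [traceNorm_nonneg (j := j) (p := p) x])
  have h : MemLp (fun t => F t x - F t 0) p (volume.restrict (Icc 0 T₀)) := by
    refine hφ.of_le_mul (c := traceNorm j p x) ((D.F_meas x hx).sub D.F_zero.1) ?_
    filter_upwards [hF] with t ht
    have := ht x hx 0 zero_mem_traceSpace (by linarith)
      (by rw [traceNorm_zero]; linarith [traceNorm_nonneg (j := j) (p := p) x])
    rw [sub_zero, mul_comm] at this
    exact this.trans (mul_le_mul_of_nonneg_left (le_abs_self _) (traceNorm_nonneg _))
  have e : (fun t => F t x) = (fun t => F t x - F t 0) + fun t => F t 0 := by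
    funext t
    simp
  rw [e]
  exact h.add D.F_zero

/-- A function in MR with initial value in `X_p` is bounded in `X_p`, so the Lipschitz data of a
single radius `R` serve at all times. No smallness is involved. -/
theorem memLp_perturbation (D : QuasilinearCoefficients j p T₀ A F) (hp : 1 ≤ p) (hp' : p ≠ ∞)
    (hT : 0 ≤ T) (hTT : T ≤ T₀) (hx₀ : x₀ ∈ traceSpace j p) (v : MRSpace j p (Icc 0 T))
    (hv : v.val 0 ∈ traceSpace j p) :
    MemLp (v.perturbation A F x₀) p (volume.restrict (Icc 0 T)) := by
  have hsub : Icc 0 T ⊆ Icc 0 T₀ := Icc_subset_Icc le_rfl hTT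
  have hle := Measure.restrict_mono (μ := volume) hsub le_rfl
  have hvm : ∀ t ∈ Icc 0 T, v.val t ∈ traceSpace j p :=
    fun t ht => v.val_mem_traceSpace_of_val_zero_mem hv ht
  obtain ⟨R, hR, hx₀R, hvR⟩ : ∃ R, 0 < R ∧ traceNorm j p x₀ ≤ R ∧
      ∀ t ∈ Icc 0 T, traceNorm j p (v.val t) ≤ R := by
    have h1 := traceNorm_nonneg (j := j) (p := p) x₀
    have h2 := traceNorm_nonneg (j := j) (p := p) (v.val 0)
    have h3 := v.norm_nonneg
    refine ⟨traceNorm j p x₀ + (v.norm + 2 * traceNorm j p (v.val 0)) + 1, by positivity,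
      by linarith, fun t ht => ?_⟩
    linarith [v.traceNorm_val_le_add hp hv ht]
  obtain ⟨C, hC, hA⟩ := D.A_lip R hR
  obtain ⟨φ, hφ, hF⟩ := D.F_lip R hR
  replace hF := ae_mono hle hF
  have hAm : ∀ y, AEStronglyMeasurable (fun t => A t (v.val t) y) (volume.restrict (Icc 0 T)) := by
    intro y
    refine v.aestronglyMeasurable_comp_val hp hp' hT hv (G := fun t x => A t x y)
      (ψ := fun _ => C * ‖y‖) (fun x hx => (D.A_meas x hx y).mono_measure hle) ?_
    filter_upwards [ae_restrict_mem measurableSet_Icc] with t ht s hs s' hs'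
    refine (hA t (hsub ht) _ (hvm s hs) _ (hvm s' hs') (hvR s hs) (hvR s' hs') y).trans
      (le_of_eq (by ring))
  have hFm : AEStronglyMeasurable (fun t => F t (v.val t)) (volume.restrict (Icc 0 T)) := by
    refine v.aestronglyMeasurable_comp_val hp hp' hT hv (G := F) (ψ := φ)
      (fun x hx => (D.F_meas x hx).mono_measure hle) ?_
    filter_upwards [hF] with t ht s hs s' hs'
    exact ht _ (hvm s hs) _ (hvm s' hs') (hvR s hs) (hvR s' hs')
  have hdR : ∀ t ∈ Icc 0 T, traceNorm j p (x₀ - v.val t) ≤ 2 * R := by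
    intro t ht
    have h1 := traceNorm_add_le hp hx₀ (neg_mem_traceSpace (hvm t ht))
    have h2 := traceNorm_neg_le (hvm t ht)
    rw [← sub_eq_add_neg] at h1
    linarith [hvR t ht]
  refine MemLp.add ?_ ?_
  · refine v.memLp_lift.of_le_mul (c := C * (2 * R))
      ((aestronglyMeasurable_clm_apply (B := fun t => A t x₀)
        (fun y => (D.A_meas x₀ hx₀ y).mono_measure hle) v.memLp_lift.1).sub
      (aestronglyMeasurable_clm_apply (B := fun t => A t (v.val t)) hAm v.memLp_lift.1)) ?_
    filter_upwards [ae_restrict_mem measurableSet_Icc] with t ht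
    refine (hA t (hsub ht) _ hx₀ _ (hvm t ht) hx₀R (hvR t ht) _).trans ?_
    gcongr
    exact hdR t ht
  · have h : MemLp (fun t => F t (v.val t) - F t x₀) p (volume.restrict (Icc 0 T)) := by
      refine (hφ.mono_measure hle).of_le_mul (c := 2 * R)
        (hFm.sub ((D.F_meas x₀ hx₀).mono_measure hle)) ?_
      filter_upwards [hF, ae_restrict_mem measurableSet_Icc] with t ht htm
      have h1 := ht _ (hvm t htm) _ hx₀ (hvR t htm) hx₀R
      rw [traceNorm_sub_comm (hvm t htm) hx₀, mul_comm] at h1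
      exact h1.trans ((mul_le_mul_of_nonneg_left (le_abs_self _) (traceNorm_nonneg _)).trans
        (mul_le_mul_of_nonneg_right (hdR t htm) (abs_nonneg _)))
    have e : (fun t => F t (v.val t)) = (fun t => F t (v.val t) - F t x₀) + fun t => F t x₀ := by
      funext t
      simp
    rw [e]
    exact h.add ((D.memLp_F hx₀).mono_measure hle)

end QuasilinearCoefficients

/-- Lipschitz estimate for the perturbation, localised to a set `S` outside of which the two
functions coincide. -/
theorem lpNormOn_perturbation_sub_le (hp : 1 ≤ p) {S : Set ℝ} (hS : MeasurableSet S)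
    (hST : S ⊆ Icc 0 T) (u v : MRSpace j p (Icc 0 T)) {a b C : ℝ} {φ : ℝ → ℝ} (ha : 0 ≤ a)
    (hb : 0 ≤ b) (hC : 0 ≤ C) (hφ : MemLp φ p (volume.restrict (Icc 0 T)))
    (hA₀ : ∀ t ∈ Icc 0 T, ∀ y, ‖A t x₀ y - A t (u.val t) y‖ ≤ a * ‖y‖)
    (hA : ∀ t ∈ Icc 0 T, ∀ y,
      ‖A t (u.val t) y - A t (v.val t) y‖ ≤ C * traceNorm j p (u.val t - v.val t) * ‖y‖)
    (hF : ∀ᵐ t ∂(volume.restrict (Icc 0 T)),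
      ‖F t (u.val t) - F t (v.val t)‖ ≤ φ t * traceNorm j p (u.val t - v.val t))
    (hub : ∀ t ∈ Icc 0 T, traceNorm j p (u.val t - v.val t) ≤ b)
    (hus : ∀ t ∈ Icc 0 T, t ∉ S → traceNorm j p (u.val t - v.val t) = 0) :
    lpNormOn (u.perturbation A F x₀ - v.perturbation A F x₀) p (Icc 0 T) ≤
      a * (u - v).norm + b * (C * lpNormOn v.lift p S + lpNormOn φ p S) := by
  have hle := Measure.restrict_mono (μ := volume) hST le_rfl
  have hlS := v.memLp_lift.mono_measure hle
  have hφS := hφ.mono_measure hle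
  set h : ℝ → ℝ := fun t => C * ‖v.lift t‖ + |φ t| with hh
  have hm : MemLp h p (volume.restrict S) := (hlS.norm.const_mul C).add hφS.norm
  have hn : lpNormOn h p S ≤ C * lpNormOn v.lift p S + 1 * lpNormOn φ p S := by
    refine lpNormOn_le_of_le_add hp hC zero_le_one hlS hφS (Eventually.of_forall fun t => ?_)
    rw [Real.norm_of_nonneg (by positivity), one_mul, Real.norm_eq_abs]
  have hm' : MemLp (S.indicator h) p (volume.restrict (Icc 0 T)) := by
    rw [memLp_indicator_iff_restrict hS, Measure.restrict_restrict hS, inter_eq_left.2 hST]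
    exact hm
  have key := lpNormOn_le_of_le_add (f := u.perturbation A F x₀ - v.perturbation A F x₀) hp ha hb
    (u - v).memLp_lift hm' ?_
  · rw [lpNormOn_indicator hS hST] at key
    refine key.trans (add_le_add (mul_le_mul_of_nonneg_left (u - v).lpNormOn_lift_le ha)
      (mul_le_mul_of_nonneg_left ?_ hb))
    linarith
  · filter_upwards [hF, ae_restrict_mem measurableSet_Icc] with t htF ht
    -- In this splitting only `u` has to be near `x₀`; `v` enters through its lift, multiplied by
    -- the `X_p`-distance of `u` and `v`.
    have e : (u.perturbation A F x₀ - v.perturbation A F x₀) t =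
        (A t x₀ ((u - v).lift t) - A t (u.val t) ((u - v).lift t)) -
        (A t (u.val t) (v.lift t) - A t (v.val t) (v.lift t)) +
        (F t (u.val t) - F t (v.val t)) := by
      simp only [MRSpace.perturbation, MRSpace.sub_lift, Pi.sub_apply, map_sub]
      abel
    rw [e]
    refine (norm_add_le _ _).trans ?_
    refine (add_le_add (norm_sub_le _ _) le_rfl).trans ?_
    have h1 := hA₀ t ht ((u - v).lift t)
    have h2 := hA t ht (v.lift t)
    have h3 : C * traceNorm j p (u.val t - v.val t) * ‖v.lift t‖ +
        φ t * traceNorm j p (u.val t - v.val t) ≤ b * ‖S.indicator h t‖ := by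
      by_cases htS : t ∈ S
      · rw [indicator_of_mem htS, Real.norm_of_nonneg (by positivity), hh]
        have h4 : C * traceNorm j p (u.val t - v.val t) * ‖v.lift t‖ +
            φ t * traceNorm j p (u.val t - v.val t) ≤
            traceNorm j p (u.val t - v.val t) * (C * ‖v.lift t‖ + |φ t|) := by
          have := mul_le_mul_of_nonneg_right (le_abs_self (φ t))
            (traceNorm_nonneg (j := j) (p := p) (u.val t - v.val t))
          linarith
        exact h4.trans (mul_le_mul_of_nonneg_right (hub t ht) (by positivity))
      · rw [hus t ht htS, indicator_of_notMem htS]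
        simp
    linarith

/-- Comparison with the constant state `x₀`. When `a` and the norm of `v` are both of order `r`, the
operator part is of order `r²`, which yields the self-mapping property. -/
theorem lpNormOn_perturbation_le (hp : 1 ≤ p) (v : MRSpace j p (Icc 0 T)) {a b : ℝ} {φ : ℝ → ℝ}
    (ha : 0 ≤ a) (hb : 0 ≤ b) (hφ : MemLp φ p (volume.restrict (Icc 0 T)))
    (hF₀ : MemLp (fun t => F t x₀) p (volume.restrict (Icc 0 T)))
    (hA₀ : ∀ t ∈ Icc 0 T, ∀ y, ‖A t x₀ y - A t (v.val t) y‖ ≤ a * ‖y‖)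
    (hF : ∀ᵐ t ∂(volume.restrict (Icc 0 T)), ‖F t (v.val t) - F t x₀‖ ≤ b * |φ t|) :
    lpNormOn (v.perturbation A F x₀) p (Icc 0 T) ≤
      a * v.norm + b * lpNormOn φ p (Icc 0 T) + lpNormOn (fun t => F t x₀) p (Icc 0 T) := by
  have hm : MemLp (fun t => a * ‖v.lift t‖ + b * ‖φ t‖) p (volume.restrict (Icc 0 T)) :=
    (v.memLp_lift.norm.const_mul a).add (hφ.norm.const_mul b)
  have h1 : lpNormOn (fun t => a * ‖v.lift t‖ + b * ‖φ t‖) p (Icc 0 T) ≤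
      a * lpNormOn v.lift p (Icc 0 T) + b * lpNormOn φ p (Icc 0 T) := by
    refine lpNormOn_le_of_le_add hp ha hb v.memLp_lift hφ (Eventually.of_forall fun t => ?_)
    rw [Real.norm_of_nonneg (by positivity)]
  have h2 : lpNormOn (v.perturbation A F x₀) p (Icc 0 T) ≤
      1 * lpNormOn (fun t => a * ‖v.lift t‖ + b * ‖φ t‖) p (Icc 0 T) +
        1 * lpNormOn (fun t => F t x₀) p (Icc 0 T) := by
    refine lpNormOn_le_of_le_add hp zero_le_one zero_le_one hm hF₀ ?_
    filter_upwards [hF, ae_restrict_mem measurableSet_Icc] with t htF ht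
    have e : v.perturbation A F x₀ t = (A t x₀ (v.lift t) - A t (v.val t) (v.lift t)) +
        (F t (v.val t) - F t x₀) + F t x₀ := by
      simp only [MRSpace.perturbation]
      abel
    rw [e, one_mul, one_mul, Real.norm_of_nonneg (by positivity)]
    refine (norm_add_le _ _).trans (add_le_add ((norm_add_le _ _).trans ?_) le_rfl)
    exact add_le_add (hA₀ t ht _) htF
  have h3 := mul_le_mul_of_nonneg_left v.lpNormOn_lift_le ha
  linarith

end QuasilinearProblem

/-! ### Uniqueness and Lipschitz dependence on the initial value. -/

section WellPosedness

variable {X₀ X₁ : Type*} [NormedAddCommGroup X₀] [NormedSpace ℝ X₀]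
  [NormedAddCommGroup X₁] [NormedSpace ℝ X₁] {j : X₁ →L[ℝ] X₀} {p : ℝ≥0∞} {T₀ T M K : ℝ}
  {A : ℝ → X₀ → X₁ →L[ℝ] X₀} {F : ℝ → X₀ → X₀} {x₀ : X₀}

theorem IsQuasilinearSolution.residual_ae_eq {x : X₀} {u : MRSpace j p (Icc 0 T)}
    (hu : IsQuasilinearSolution A F x u) :
    u.residual (fun t => A t x₀) =ᵐ[volume.restrict (Icc 0 T)] u.perturbation A F x₀ :=
  (isQuasilinearSolution_iff.1 hu).2

theorem IsQuasilinearSolution.lpNormOn_residual_sub {x y : X₀} {u v : MRSpace j p (Icc 0 T)}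
    (hu : IsQuasilinearSolution A F x u) (hv : IsQuasilinearSolution A F y v) :
    lpNormOn ((u - v).residual fun t => A t x₀) p (Icc 0 T) =
      lpNormOn (u.perturbation A F x₀ - v.perturbation A F x₀) p (Icc 0 T) := by
  rw [MRSpace.residual_sub]
  exact lpNormOn_congr_ae (hu.residual_ae_eq.sub hv.residual_ae_eq)

/-- If two solutions with the same initial value coincide up to time `s` and the coefficients are
small in `L^p(s, T)`, then they coincide on `[0, T]`. -/
theorem IsQuasilinearSolution.eqOn_of_eqOn (hp : 1 ≤ p)
    (h : IsUniformlyMaximallyRegular j p T₀ (fun t => A t x₀) M K) (hT : 0 < T) (hTT : T ≤ T₀)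
    {x : X₀} {u v : MRSpace j p (Icc 0 T)} (hu : IsQuasilinearSolution A F x u)
    (hv : IsQuasilinearSolution A F x v) {a C s : ℝ} {φ : ℝ → ℝ} (ha : 0 ≤ a) (hC : 0 ≤ C)
    (hφ : MemLp φ p (volume.restrict (Icc 0 T))) (hs : 0 ≤ s)
    (hA₀ : ∀ t ∈ Icc 0 T, ∀ y, ‖A t x₀ y - A t (u.val t) y‖ ≤ a * ‖y‖)
    (hA : ∀ t ∈ Icc 0 T, ∀ y,
      ‖A t (u.val t) y - A t (v.val t) y‖ ≤ C * traceNorm j p (u.val t - v.val t) * ‖y‖)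
    (hF : ∀ᵐ t ∂(volume.restrict (Icc 0 T)),
      ‖F t (u.val t) - F t (v.val t)‖ ≤ φ t * traceNorm j p (u.val t - v.val t))
    (hsmall : K * (a + (C * lpNormOn v.lift p (Icc s T) + lpNormOn φ p (Icc s T))) ≤ 1 / 2)
    (heq : ∀ t ∈ Icc 0 T, t < s → u.val t = v.val t) : EqOn u.val v.val (Icc 0 T) := by
  have hd0 : (u - v).val 0 = 0 := by simp [hu.1, hv.1]
  have h1 := h.estimate T hT hTT (u - v) hd0 (h.memLp_residual hTT _)
  rw [hu.lpNormOn_residual_sub hv] at h1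
  -- With `S = [s, T]` and `b` the norm of `u - v`, the smallness assumption makes this norm at most
  -- half of itself, hence zero.
  have h2 := lpNormOn_perturbation_sub_le (x₀ := x₀) hp measurableSet_Icc
    (Icc_subset_Icc_left hs) u v ha (u - v).norm_nonneg hC hφ hA₀ hA hF
    (fun t ht => (u - v).traceNorm_val_le_of_val_zero hd0 ht) (fun t ht hts => by
      rw [heq t ht (not_le.1 fun h => hts ⟨h, ht.2⟩), sub_self, traceNorm_zero])
  have h3 := h1.trans (mul_le_mul_of_nonneg_left h2 h.K_nonneg)
  have h4 := mul_le_mul_of_nonneg_right hsmall (u - v).norm_nonneg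
  have h5 : (u - v).norm = 0 := le_antisymm (by linarith) (u - v).norm_nonneg
  intro t ht
  have h6 := (u - v).val_eq_zero_of_norm_eq_zero hp hd0 h5 ht
  exact sub_eq_zero.1 h6

theorem IsQuasilinearSolution.restrict {τ : ℝ} (hτT : τ ≤ T) {x : X₀} {u : MRSpace j p (Icc 0 T)}
    (hu : IsQuasilinearSolution A F x u) :
    IsQuasilinearSolution A F x (u.restrict (Icc_subset_Icc_right hτT)) :=
  ⟨hu.1, ae_restrict_of_ae_restrict_of_subset (Icc_subset_Icc_right hτT) hu.2⟩

/-- Unconditional uniqueness: a solution which stays in a region where `A(t, u(t))` is a small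
perturbation of `A(t, x₀)` is the only one. -/
theorem IsQuasilinearSolution.eqOn (hp : 1 ≤ p) (hp' : p ≠ ∞)
    (D : QuasilinearCoefficients j p T₀ A F)
    (h : IsUniformlyMaximallyRegular j p T₀ (fun t => A t x₀) M K) (hT : 0 < T) (hTT : T ≤ T₀)
    {x : X₀} (hx : x ∈ traceSpace j p) {u v : MRSpace j p (Icc 0 T)}
    (hu : IsQuasilinearSolution A F x u)
    (hv : IsQuasilinearSolution A F x v) {a : ℝ} (ha : 0 ≤ a)
    (hA₀ : ∀ t ∈ Icc 0 T, ∀ y, ‖A t x₀ y - A t (u.val t) y‖ ≤ a * ‖y‖) (hKa : K * a ≤ 1 / 4) :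
    EqOn u.val v.val (Icc 0 T) := by
  have hu0 : u.val 0 ∈ traceSpace j p := hu.1 ▸ hx
  have hv0 : v.val 0 ∈ traceSpace j p := hv.1 ▸ hx
  have hsub : Icc 0 T ⊆ Icc 0 T₀ := Icc_subset_Icc_right hTT
  obtain ⟨R, hR, huR, hvR⟩ : ∃ R, 0 < R ∧ (∀ t ∈ Icc 0 T, traceNorm j p (u.val t) ≤ R) ∧
      ∀ t ∈ Icc 0 T, traceNorm j p (v.val t) ≤ R := by
    have h1 := traceNorm_nonneg (j := j) (p := p) (u.val 0)
    have h2 := traceNorm_nonneg (j := j) (p := p) (v.val 0)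
    have h3 := u.norm_nonneg
    have h4 := v.norm_nonneg
    refine ⟨(u.norm + 2 * traceNorm j p (u.val 0)) + (v.norm + 2 * traceNorm j p (v.val 0)) + 1,
      by positivity, fun t ht => ?_, fun t ht => ?_⟩
    · linarith [u.traceNorm_val_le_add hp hu0 ht]
    · linarith [v.traceNorm_val_le_add hp hv0 ht]
  obtain ⟨C, hC, hA⟩ := D.A_lip R hR
  obtain ⟨φ, hφ, hF⟩ := D.F_lip R hR
  replace hφ := hφ.mono_measure (Measure.restrict_mono (μ := volume) hsub le_rfl)
  replace hF := ae_restrict_of_ae_restrict_of_subset hsub hF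
  have hum := fun t ht => u.val_mem_traceSpace_of_val_zero_mem hu0 (t := t) ht
  have hvm := fun t ht => v.val_mem_traceSpace_of_val_zero_mem hv0 (t := t) ht
  have hK1 : 0 < K + 1 := by linarith [h.K_nonneg]
  -- Nothing is known about the size of `v`, but absolute continuity of the norm gives a window
  -- length that works at every position. `K + 1` replaces `K` to avoid dividing by zero.
  obtain ⟨δ₁, hδ₁, H₁⟩ := exists_lpNormOn_Icc_le hp hp' v.memLp_lift
    (show 0 < 1 / (8 * C * (K + 1)) by positivity)
  obtain ⟨δ₂, hδ₂, H₂⟩ := exists_lpNormOn_Icc_le hp hp' hφ (show 0 < 1 / (8 * (K + 1)) by positivity)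
  obtain ⟨δ, hδ, hδ1, hδ2⟩ : ∃ δ, 0 < δ ∧ δ ≤ δ₁ ∧ δ ≤ δ₂ :=
    ⟨min δ₁ δ₂, lt_min hδ₁ hδ₂, min_le_left _ _, min_le_right _ _⟩
  have key : ∀ n : ℕ, ∀ t ∈ Icc 0 T, t ≤ n * δ → u.val t = v.val t := by
    intro n
    induction n with
    | zero =>
      intro t ht ht'
      rw [Nat.cast_zero, zero_mul] at ht'
      rw [le_antisymm ht' ht.1, hu.1, hv.1]
    | succ n ih =>
      intro t ht ht'
      -- Each step compares the solutions on all of `[0, τ]`, where the difference lives only on the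
      -- last window, so only linear problems starting at time zero are used.
      set τ := min ((n + 1 : ℕ) * δ) T
      have hτ : 0 < τ := lt_min (by positivity) hT
      have hτT : τ ≤ T := min_le_right _ _
      have hIτ : Icc 0 τ ⊆ Icc 0 T := Icc_subset_Icc_right hτT
      have hs : (0 : ℝ) ≤ n * δ := by positivity
      have hτs : τ - n * δ ≤ δ := by
        have : τ ≤ (n + 1 : ℕ) * δ := min_le_left _ _
        push_cast at this
        linarith
      have hS : Icc (n * δ) τ ⊆ Icc 0 T := Icc_subset_Icc hs hτT
      refine IsQuasilinearSolution.eqOn_of_eqOn (s := n * δ) (C := C) (φ := φ) hp h hτ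
        (hτT.trans hTT) (hu.restrict hτT) (hv.restrict hτT) ha hC.le
        (hφ.mono_measure (Measure.restrict_mono hIτ le_rfl)) hs (fun r hr => hA₀ r (hIτ hr))
        (fun r hr => hA r (hsub (hIτ hr)) _ (hum r (hIτ hr)) _ (hvm r (hIτ hr)) (huR r (hIτ hr))
          (hvR r (hIτ hr))) ?_ ?_ (fun r hr hrs => ih r (hIτ hr) hrs.le) ⟨ht.1, le_min ht' ht.2⟩
      · filter_upwards [ae_restrict_of_ae_restrict_of_subset hIτ hF,
          ae_restrict_mem measurableSet_Icc] with r hr hrm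
        exact hr _ (hum r (hIτ hrm)) _ (hvm r (hIτ hrm)) (huR r (hIτ hrm)) (hvR r (hIτ hrm))
      · have h1 := H₁ _ _ hS (hτs.trans hδ1)
        have h2 := H₂ _ _ hS (hτs.trans hδ2)
        have h3 : C * lpNormOn v.lift p (Icc (n * δ) τ) + lpNormOn φ p (Icc (n * δ) τ) ≤
            1 / (4 * (K + 1)) := by
          have h4 := mul_le_mul_of_nonneg_left h1 hC.le
          have h5 : C * (1 / (8 * C * (K + 1))) + 1 / (8 * (K + 1)) = 1 / (4 * (K + 1)) := by
            field_simp
            norm_num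
          linarith
        have h6 := mul_le_mul_of_nonneg_left h3 h.K_nonneg
        have h7 : K * (1 / (4 * (K + 1))) ≤ 1 / 4 := by
          rw [mul_one_div, div_le_div_iff₀ (by positivity) (by norm_num)]
          linarith
        rw [mul_add]
        exact (add_le_add hKa (h6.trans h7)).trans (by norm_num)
  intro t ht
  obtain ⟨n, hn⟩ := exists_nat_ge (t / δ)
  exact key n t ht ((div_le_iff₀ hδ).1 hn)

/-- Lipschitz dependence on the initial value of solutions close to `x₀`. -/
theorem IsQuasilinearSolution.norm_sub_le (hp : 1 ≤ p)
    (h : IsUniformlyMaximallyRegular j p T₀ (fun t => A t x₀) M K) (hT : 0 < T) (hTT : T ≤ T₀)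
    {x y : X₀} (hx : x ∈ traceSpace j p) (hy : y ∈ traceSpace j p) {u v : MRSpace j p (Icc 0 T)}
    (hu : IsQuasilinearSolution A F x u) (hv : IsQuasilinearSolution A F y v) {a C : ℝ}
    {φ : ℝ → ℝ} (ha : 0 ≤ a) (hC : 0 ≤ C) (hφ : MemLp φ p (volume.restrict (Icc 0 T)))
    (hA₀ : ∀ t ∈ Icc 0 T, ∀ y, ‖A t x₀ y - A t (u.val t) y‖ ≤ a * ‖y‖)
    (hA : ∀ t ∈ Icc 0 T, ∀ y,
      ‖A t (u.val t) y - A t (v.val t) y‖ ≤ C * traceNorm j p (u.val t - v.val t) * ‖y‖)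
    (hF : ∀ᵐ t ∂(volume.restrict (Icc 0 T)),
      ‖F t (u.val t) - F t (v.val t)‖ ≤ φ t * traceNorm j p (u.val t - v.val t))
    (hsmall : K * (a + (C * lpNormOn v.lift p (Icc 0 T) + lpNormOn φ p (Icc 0 T))) ≤ 1 / 2) :
    (u - v).norm ≤ 2 * (2 + K * (1 + M)) * traceNorm j p (x - y) := by
  have hK := h.K_nonneg
  have hM := h.M_nonneg
  set e := traceNorm j p (x - y)
  have he : 0 ≤ e := traceNorm_nonneg _
  have hxy := sub_mem_traceSpace hx hy
  have hd0 : (u - v).val 0 = x - y := by simp [hu.1, hv.1]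
  have hd0m : (u - v).val 0 ∈ traceSpace j p := hd0 ▸ hxy
  have hb : ∀ t ∈ Icc 0 T, traceNorm j p (u.val t - v.val t) ≤ (u - v).norm + 2 * e := by
    intro t ht
    have := (u - v).traceNorm_val_le_add hp hd0m ht
    rwa [hd0] at this
  have h2 := lpNormOn_perturbation_sub_le (x₀ := x₀) hp measurableSet_Icc subset_rfl u v ha
    (add_nonneg (u - v).norm_nonneg (by positivity)) hC hφ hA₀ hA hF hb
    (fun t ht hts => absurd ht hts)
  set q := C * lpNormOn v.lift p (Icc 0 T) + lpNormOn φ p (Icc 0 T)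
  have h3 := mul_le_mul_of_nonneg_left h2 hK
  have h4 := mul_le_mul_of_nonneg_right hsmall (u - v).norm_nonneg
  -- Unequal initial values add `2e` to the bound on the `X_p`-distance; the smallness assumption,
  -- with `K * a` dropped, absorbs the resulting term.
  have h5 : K * q * e ≤ 1 / 2 * e := by
    refine mul_le_mul_of_nonneg_right ?_ he
    have := mul_nonneg hK ha
    linarith
  -- The infimum defining `e` need not be attained, so `x - y` is lifted with norm below `ζ`, and
  -- `ζ` then decreases to `e`.
  have hbound : ∀ ζ, e < ζ → (u - v).norm ≤ 2 * e + 2 * (1 + K * (1 + M)) * ζ := by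
    intro ζ hζ
    obtain ⟨w, hw, hwn⟩ := exists_norm_lt_of_traceNorm_lt hxy hζ
    set z : MRSpace j p (Icc 0 T) := w.restrict Icc_subset_Ici_self
    have hz : z.norm ≤ ζ := (w.norm_restrict_le _).trans hwn.le
    have h6 := h.norm_sub_le hp hT hTT (u - v) z (by rw [hd0, ← hw]; rfl)
    rw [hu.lpNormOn_residual_sub hv] at h6
    have h7 := MRSpace.norm_le_sub_add hp (u - v) z
    have h8 : K * (1 + M) * z.norm ≤ K * (1 + M) * ζ := by gcongr
    nlinarith
  refine le_of_forall_pos_le_add fun η hη => ?_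
  have hc : 0 < 2 * (1 + K * (1 + M)) := by positivity
  have := hbound (e + η / (2 * (1 + K * (1 + M)))) (by linarith [div_pos hη hc])
  rw [mul_add, mul_div_cancel₀ _ hc.ne'] at this
  linarith

end WellPosedness

/-! ### Existence near `x₀` on a short interval. -/

section Existence

variable {X₀ X₁ : Type*} [NormedAddCommGroup X₀] [NormedSpace ℝ X₀]
  [NormedAddCommGroup X₁] [NormedSpace ℝ X₁] {j : X₁ →L[ℝ] X₀} {p : ℝ≥0∞} {T₀ T M K : ℝ}
  {A : ℝ → X₀ → X₁ →L[ℝ] X₀} {F : ℝ → X₀ → X₀} {x₀ : X₀}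

/-- Keeps all states in the ball of radius `traceNorm j p x₀ + 1`, for which one pair `C`, `φ` is
fixed. -/
theorem traceNorm_le_add_one (hp : 1 ≤ p) {x : X₀} (hx : x ∈ traceSpace j p)
    (hx₀ : x₀ ∈ traceSpace j p) {ρ : ℝ} (hρ : ρ ≤ 1) (h : traceNorm j p (x - x₀) ≤ ρ) :
    traceNorm j p x ≤ traceNorm j p x₀ + 1 := by
  linarith [traceNorm_le_sub_add hp hx hx₀]

/-- Solutions of the linear problem with a small right-hand side and an initial value close to
`x₀` are small in the maximal regularity space and stay close to `x₀`. -/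
theorem IsLinearSolution.norm_le_and_traceNorm_sub_le {B : ℝ → X₁ →L[ℝ] X₀} (hp : 1 ≤ p)
    (h : IsUniformlyMaximallyRegular j p T₀ B M K) (hT : 0 < T) (hTT : T ≤ T₀)
    {w₀ : MRSpace j p (Ici 0)} (hw₀ : w₀.val 0 = x₀) {r : ℝ} (hr : 0 < r)
    (hw₀n : (w₀.restrict (I := Icc 0 T) Icc_subset_Ici_self).norm ≤ r)
    (hw₀t : ∀ t ∈ Icc 0 T, traceNorm j p (w₀.val t - x₀) ≤ r)
    {x : X₀} (hx : x ∈ traceSpace j p) (hxr : traceNorm j p (x - x₀) ≤ r)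
    {g : ℝ → X₀} (hg : lpNormOn g p (Icc 0 T) ≤ r)
    {v : MRSpace j p (Icc 0 T)} (hv : IsLinearSolution B g x v) :
    v.norm ≤ (K * (4 + 3 * M) + 3) * r ∧
      ∀ t ∈ Icc 0 T, traceNorm j p (v.val t - x₀) ≤ (K * (4 + 3 * M) + 3) * r := by
  have hx₀ : x₀ ∈ traceSpace j p := ⟨w₀, hw₀⟩
  -- The reference function `w₀ + z` has initial value `x` and norm at most `r + 2r`. The linear
  -- estimate contributes `K(r + (1 + M)3r) = K(4 + 3M)r`, and adding `3r` back gives the constant.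
  obtain ⟨z, hz, hzn⟩ := exists_norm_lt_of_traceNorm_lt (sub_mem_traceSpace hx hx₀)
    (show traceNorm j p (x - x₀) < 2 * r by linarith)
  set w : MRSpace j p (Icc 0 T) := (w₀ + z).restrict Icc_subset_Ici_self with hwdef
  have hw0 : w.val 0 = x := by simp [hwdef, hw₀, hz]
  have hwn : w.norm ≤ 3 * r := by
    have h1 := MRSpace.norm_add_le hp (w₀.restrict (I := Icc 0 T) Icc_subset_Ici_self)
      (z.restrict (I := Icc 0 T) Icc_subset_Ici_self)
    have h2 := z.norm_restrict_le (I := Icc 0 T) Icc_subset_Ici_self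
    have h3 : w.norm = (w₀.restrict (I := Icc 0 T) Icc_subset_Ici_self +
      z.restrict (I := Icc 0 T) Icc_subset_Ici_self).norm := rfl
    linarith
  have hvw0 : v.val 0 = w.val 0 := hv.1.trans hw0.symm
  have hd : (v - w).norm ≤ K * (4 + 3 * M) * r := by
    have h1 := h.norm_sub_le hp hT hTT v w hvw0
    have h2 : v.residual B =ᵐ[volume.restrict (Icc 0 T)] g := hv.2
    rw [lpNormOn_congr_ae h2] at h1
    have h3 : lpNormOn g p (Icc 0 T) + (1 + M) * w.norm ≤ (4 + 3 * M) * r := by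
      have := mul_le_mul_of_nonneg_left hwn (show 0 ≤ 1 + M by linarith [h.M_nonneg])
      linarith
    rw [mul_assoc]
    exact h1.trans (mul_le_mul_of_nonneg_left h3 h.K_nonneg)
  refine ⟨?_, fun t ht => ?_⟩
  · linarith [MRSpace.norm_le_sub_add hp v w]
  · have hd0 : (v - w).val 0 = 0 := by simp [hvw0]
    have h1 := ((v - w).traceNorm_val_le_of_val_zero hd0 ht).trans hd
    have m1 := (v - w).val_mem_traceSpace_of_val_zero hd0 ht
    have m2 := z.val_mem_traceSpace ht.1
    have m3 := sub_mem_traceSpace (w₀.val_mem_traceSpace ht.1) hx₀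
    have h2 := (z.traceNorm_val_le ht.1).trans hzn.le
    have h3 : v.val t - x₀ = (v - w).val t + (z.val t + (w₀.val t - x₀)) := by
      simp only [hwdef, MRSpace.sub_val, MRSpace.restrict_val, MRSpace.add_val, Pi.sub_apply,
        Pi.add_apply]
      abel
    rw [h3]
    linarith [traceNorm_add_le hp m1 (add_mem_traceSpace m2 m3), traceNorm_add_le hp m2 m3,
      hw₀t t ht]

/-- Existence of a solution close to `x₀` on a short time interval. -/
theorem exists_isQuasilinearSolution [CompleteSpace X₀] (hp : 1 ≤ p) (hp' : p ≠ ∞)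
    (D : QuasilinearCoefficients j p T₀ A F)
    (h : IsUniformlyMaximallyRegular j p T₀ (fun t => A t x₀) M K) (hT : 0 < T) (hTT : T ≤ T₀)
    {w₀ : MRSpace j p (Ici 0)} (hw₀ : w₀.val 0 = x₀) {r C c : ℝ} {φ : ℝ → ℝ} (hr : 0 < r)
    (hC : 0 ≤ C) (hφ : MemLp φ p (volume.restrict (Icc 0 T)))
    (hA : ∀ t ∈ Icc 0 T, ∀ x₁ ∈ traceSpace j p, ∀ x₂ ∈ traceSpace j p,
      traceNorm j p x₁ ≤ traceNorm j p x₀ + 1 → traceNorm j p x₂ ≤ traceNorm j p x₀ + 1 →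
      ∀ y : X₁, ‖A t x₁ y - A t x₂ y‖ ≤ C * traceNorm j p (x₁ - x₂) * ‖y‖)
    (hF : ∀ᵐ t ∂(volume.restrict (Icc 0 T)), ∀ x₁ ∈ traceSpace j p, ∀ x₂ ∈ traceSpace j p,
      traceNorm j p x₁ ≤ traceNorm j p x₀ + 1 → traceNorm j p x₂ ≤ traceNorm j p x₀ + 1 →
      ‖F t x₁ - F t x₂‖ ≤ φ t * traceNorm j p (x₁ - x₂))
    (hw₀n : (w₀.restrict (I := Icc 0 T) Icc_subset_Ici_self).norm ≤ r)
    (hw₀t : ∀ t ∈ Icc 0 T, traceNorm j p (w₀.val t - x₀) ≤ r)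
    (hφr : lpNormOn φ p (Icc 0 T) ≤ r)
    (hF₀ : lpNormOn (fun t => F t x₀) p (Icc 0 T) ≤ r * r)
    (hc : c = K * (4 + 3 * M) + 3) (hcr : c * r ≤ 1) (hcr₂ : (C * c * c + c + 1) * r ≤ 1)
    (hcr₃ : K * (2 * C * c + 1) * r ≤ 1 / 4)
    {x : X₀} (hx : x ∈ traceSpace j p) (hxr : traceNorm j p (x - x₀) ≤ r) :
    ∃ u : MRSpace j p (Icc 0 T), IsQuasilinearSolution A F x u ∧ u.norm ≤ c * r ∧
      ∀ t ∈ Icc 0 T, traceNorm j p (u.val t - x₀) ≤ c * r := by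
  have hx₀ : x₀ ∈ traceSpace j p := ⟨w₀, hw₀⟩
  have hc0 : 0 ≤ c := by
    have := mul_nonneg h.K_nonneg (show 0 ≤ 4 + 3 * M by linarith [h.M_nonneg])
    linarith
  have hρ : 0 ≤ c * r := by positivity
  have hF₀m := (D.memLp_F hx₀).mono_measure
    (Measure.restrict_mono (μ := volume) (Icc_subset_Icc_right hTT) le_rfl)
  have near : ∀ g (v : MRSpace j p (Icc 0 T)), lpNormOn g p (Icc 0 T) ≤ r →
      IsLinearSolution (fun t => A t x₀) g x v →
      v.norm ≤ c * r ∧ ∀ t ∈ Icc 0 T, traceNorm j p (v.val t - x₀) ≤ c * r := by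
    intro g v hg hv
    rw [hc]
    exact hv.norm_le_and_traceNorm_sub_le hp h hT hTT hw₀ hr hw₀n hw₀t hx hxr hg
  have hmem : ∀ v : MRSpace j p (Icc 0 T), v.val 0 = x → ∀ t ∈ Icc 0 T,
      v.val t ∈ traceSpace j p :=
    fun v hv t ht => v.val_mem_traceSpace_of_val_zero_mem (hv ▸ hx) ht
  have hx₀1 : traceNorm j p x₀ ≤ traceNorm j p x₀ + 1 := by linarith
  have hA₀ : ∀ v : MRSpace j p (Icc 0 T), v.val 0 = x →
      (∀ t ∈ Icc 0 T, traceNorm j p (v.val t - x₀) ≤ c * r) →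
      ∀ t ∈ Icc 0 T, ∀ y, ‖A t x₀ y - A t (v.val t) y‖ ≤ C * (c * r) * ‖y‖ := by
    intro v hv hvn t ht y
    have hm := hmem v hv t ht
    refine (hA t ht _ hx₀ _ hm hx₀1 (traceNorm_le_add_one hp hm hx₀ hcr (hvn t ht)) y).trans ?_
    rw [traceNorm_sub_comm hx₀ hm]
    gcongr
    exact hvn t ht
  obtain ⟨g, v, hg, hgr, hv, hvg⟩ := exists_isLinearSolution_self (r := r) (T := T) (x := x)
    (B := fun t => A t x₀) (j := j) hp hr.le (N := fun v => v.perturbation A F x₀)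
    (fun g hg => by
      obtain ⟨w, hw⟩ := id hx
      have := h.exists_solution_of_val_zero hT hTT (w.restrict Icc_subset_Ici_self) hg
      rwa [MRSpace.restrict_val, hw] at this)
    (fun v hv => D.memLp_perturbation hp hp' hT.le hTT hx₀ v (hv ▸ hx))
    -- Self-mapping: the three contributions are at most `Cc²r²`, `cr²` and `r²`, and `hcr₂` bounds
    -- their sum by `r`.
    (fun g v hg hgr hv => by
      obtain ⟨h1, h2⟩ := near g v hgr hv
      have h3 := lpNormOn_perturbation_le (x₀ := x₀) hp v (mul_nonneg hC hρ) hρ hφ hF₀m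
        (hA₀ v hv.1 h2) (by
          filter_upwards [hF, ae_restrict_mem measurableSet_Icc] with t ht htm
          have hm := hmem v hv.1 t htm
          refine (ht _ hm _ hx₀ (traceNorm_le_add_one hp hm hx₀ hcr (h2 t htm)) hx₀1).trans ?_
          rw [mul_comm]
          exact (mul_le_mul_of_nonneg_left (le_abs_self _) (traceNorm_nonneg _)).trans
            (mul_le_mul_of_nonneg_right (h2 t htm) (abs_nonneg _)))
      have h4 : C * (c * r) * v.norm ≤ C * (c * r) * (c * r) := by gcongr
      have h5 : c * r * lpNormOn φ p (Icc 0 T) ≤ c * r * r := by gcongr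
      have h6 := mul_le_mul_of_nonneg_right hcr₂ hr.le
      linarith)
    -- Contraction: the perturbations differ by at most `(2Cc + 1)r` times the norm of `v₁ - v₂`,
    -- which maximal regularity bounds by `K` times the norm of `g₁ - g₂`; `hcr₃` makes the product
    -- at most a quarter.
    (fun g₁ g₂ v₁ v₂ hg₁ hg₂ hgr₁ hgr₂ hv₁ hv₂ => by
      obtain ⟨h1, h2⟩ := near g₁ v₁ hgr₁ hv₁
      obtain ⟨h3, h4⟩ := near g₂ v₂ hgr₂ hv₂
      have m1 := hmem v₁ hv₁.1
      have m2 := hmem v₂ hv₂.1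
      have b1 := fun t ht => traceNorm_le_add_one hp (m1 t ht) hx₀ hcr (h2 t ht)
      have b2 := fun t ht => traceNorm_le_add_one hp (m2 t ht) hx₀ hcr (h4 t ht)
      have hd0 : (v₁ - v₂).val 0 = 0 := by simp [hv₁.1, hv₂.1]
      have h5 := lpNormOn_perturbation_sub_le (x₀ := x₀) hp measurableSet_Icc subset_rfl v₁ v₂
        (mul_nonneg hC hρ) (v₁ - v₂).norm_nonneg hC hφ (hA₀ v₁ hv₁.1 h2)
        (fun t ht => hA t ht _ (m1 t ht) _ (m2 t ht) (b1 t ht) (b2 t ht))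
        (by
          filter_upwards [hF, ae_restrict_mem measurableSet_Icc] with t ht htm
          exact ht _ (m1 t htm) _ (m2 t htm) (b1 t htm) (b2 t htm))
        (fun t ht => (v₁ - v₂).traceNorm_val_le_of_val_zero hd0 ht)
        (fun t ht hts => absurd ht hts)
      have h6 := h.estimate T hT hTT (v₁ - v₂) hd0 (h.memLp_residual hTT _)
      have h7 : (v₁ - v₂).residual (fun t => A t x₀) =ᵐ[volume.restrict (Icc 0 T)] g₁ - g₂ := by
        rw [MRSpace.residual_sub]
        exact EventuallyEq.sub hv₁.2 hv₂.2
      rw [lpNormOn_congr_ae h7] at h6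
      have h8 : C * lpNormOn v₂.lift p (Icc 0 T) + lpNormOn φ p (Icc 0 T) ≤ C * (c * r) + r :=
        add_le_add (mul_le_mul_of_nonneg_left (v₂.lpNormOn_lift_le.trans h3) hC) hφr
      have h9 := mul_le_mul_of_nonneg_left h8 (v₁ - v₂).norm_nonneg
      have h10 := mul_le_mul_of_nonneg_left h6
        (show 0 ≤ (2 * C * c + 1) * r by positivity)
      have h11 := mul_le_mul_of_nonneg_right hcr₃ (lpNormOn_nonneg (g₁ - g₂) p (Icc 0 T))
      have h12 := lpNormOn_nonneg (g₁ - g₂) p (Icc 0 T)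
      linarith)
  obtain ⟨h1, h2⟩ := near g v hgr hv
  refine ⟨v, (isQuasilinearSolution_iff (x₀ := x₀)).2 ⟨hv.1, ?_⟩, h1, h2⟩
  filter_upwards [hv.2, hvg] with t ht ht'
  rw [ht, ← ht']

end Existence

end

/-! ### The local well-posedness theorem. -/

theorem theorem6p1 {X₀ X₁ : Type*}
    [NormedAddCommGroup X₀] [NormedSpace ℝ X₀] [CompleteSpace X₀]
    [NormedAddCommGroup X₁] [NormedSpace ℝ X₁] [CompleteSpace X₁]
    (j : X₁ →L[ℝ] X₀) (hj_inj : Function.Injective j) (hj_dense : DenseRange j)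
    (p : ℝ≥0∞) (hp_one : 1 < p) (hp_top : p < ∞) (T₀ : ℝ) (hT₀ : 0 < T₀)
    -- only the values at `t ∈ [0, T₀]` and `x ∈ X_p` matter
    (A : ℝ → X₀ → X₁ →L[ℝ] X₀) (F : ℝ → X₀ → X₀)
    (hA_meas : ∀ x ∈ traceSpace j p, ∀ y : X₁,
      AEStronglyMeasurable (fun t => A t x y) (volume.restrict (Icc 0 T₀)))
    (hA_lip : ∀ R : ℝ, 0 < R → ∃ C : ℝ, 0 < C ∧ ∀ t ∈ Icc 0 T₀,
      ∀ x₁ ∈ traceSpace j p, ∀ x₂ ∈ traceSpace j p, traceNorm j p x₁ ≤ R → traceNorm j p x₂ ≤ R →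
        ∀ y : X₁, ‖A t x₁ y - A t x₂ y‖ ≤ C * traceNorm j p (x₁ - x₂) * ‖y‖)
    (hF_meas : ∀ x ∈ traceSpace j p,
      AEStronglyMeasurable (fun t => F t x) (volume.restrict (Icc 0 T₀)))
    (hF_cont : ∀ᵐ t ∂(volume.restrict (Icc 0 T₀)), ∀ x ∈ traceSpace j p, ∀ η : ℝ, 0 < η →
      ∃ δ : ℝ, 0 < δ ∧ ∀ y ∈ traceSpace j p, traceNorm j p (y - x) < δ → ‖F t y - F t x‖ < η)
    (hF_zero : MemLp (fun t => F t 0) p (volume.restrict (Icc 0 T₀)))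
    (hF_lip : ∀ R : ℝ, 0 < R → ∃ φ : ℝ → ℝ, MemLp φ p (volume.restrict (Icc 0 T₀)) ∧
      ∀ᵐ t ∂(volume.restrict (Icc 0 T₀)),
        ∀ x₁ ∈ traceSpace j p, ∀ x₂ ∈ traceSpace j p,
          traceNorm j p x₁ ≤ R → traceNorm j p x₂ ≤ R →
            ‖F t x₁ - F t x₂‖ ≤ φ t * traceNorm j p (x₁ - x₂))
    (x₀ : X₀) (hx₀ : x₀ ∈ traceSpace j p)
    (hA_bdd : ∃ M : ℝ, ∀ t ∈ Icc 0 T₀, ∀ y : X₁, ‖A t x₀ y‖ ≤ M * ‖y‖)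
    (hA_maxreg : ∀ T : ℝ, 0 < T → T ≤ T₀ → HasMaximalRegularity j p 0 T (fun t => A t x₀)) :
    ∃ T : ℝ, 0 < T ∧ T ≤ T₀ ∧ ∃ ε : ℝ, 0 < ε ∧
      (∀ x ∈ traceSpace j p, traceNorm j p (x - x₀) ≤ ε →
        ∃ u : MRSpace j p (Icc 0 T), IsQuasilinearSolution A F x u ∧
          (∀ t ∈ Icc 0 T, u.val t ∈ traceSpace j p) ∧
          ∀ v : MRSpace j p (Icc 0 T), IsQuasilinearSolution A F x v →
            EqOn v.val u.val (Icc 0 T)) ∧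
      ∃ C : ℝ, ∀ x ∈ traceSpace j p, ∀ y ∈ traceSpace j p,
        traceNorm j p (x - x₀) ≤ ε → traceNorm j p (y - x₀) ≤ ε →
          ∀ u v : MRSpace j p (Icc 0 T),
            IsQuasilinearSolution A F x u → IsQuasilinearSolution A F y v →
              (u - v).norm ≤ C * traceNorm j p (x - y) := by
  have hp : 1 ≤ p := hp_one.le
  have hp' : p ≠ ∞ := hp_top.ne
  have D : QuasilinearCoefficients j p T₀ A F := ⟨hA_meas, hA_lip, hF_meas, hF_zero, hF_lip⟩
  obtain ⟨M, K, h⟩ := exists_isUniformlyMaximallyRegular hj_inj hp hT₀ (hA_meas x₀ hx₀) hA_bdd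
    hA_maxreg
  obtain ⟨w₀, hw₀⟩ := id hx₀
  have hR : 0 < traceNorm j p x₀ + 1 := by linarith [traceNorm_nonneg (j := j) (p := p) x₀]
  obtain ⟨C, hC, hA⟩ := D.A_lip _ hR
  obtain ⟨φ, hφ, hF⟩ := D.F_lip _ hR
  have hK := h.K_nonneg
  have hM := h.M_nonneg
  obtain ⟨c, hc⟩ : ∃ c, c = K * (4 + 3 * M) + 3 := ⟨_, rfl⟩
  have hc0 : 0 < c := by rw [hc]; positivity
  -- The radius `r` is fixed before `T`, which is possible because `c`, `C` and `K` do not depend on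
  -- `T`. The denominator is the sum of what the three conditions require.
  obtain ⟨r, hr, hcr, hcr₂, hcr₃⟩ : ∃ r, 0 < r ∧ c * r ≤ 1 ∧ (C * c * c + c + 1) * r ≤ 1 ∧
      K * (2 * C * c + 1) * r ≤ 1 / 4 := by
    refine ⟨1 / (C * c * c + c + 1 + 4 * (K * (2 * C * c + 1))), by positivity, ?_, ?_, ?_⟩
    · rw [mul_one_div]
      refine div_le_one_of_le₀ ?_ (by positivity)
      have : 0 ≤ C * c * c + 1 + 4 * (K * (2 * C * c + 1)) := by positivity
      linarith
    · rw [mul_one_div]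
      refine div_le_one_of_le₀ ?_ (by positivity)
      have : 0 ≤ 4 * (K * (2 * C * c + 1)) := by positivity
      linarith
    · rw [mul_one_div, div_le_div_iff₀ (by positivity) (by norm_num)]
      have : 0 ≤ C * c * c + c + 1 := by positivity
      linarith
  obtain ⟨δ₁, hδ₁, H₁⟩ := w₀.exists_norm_restrict_le hp hp' hr
  obtain ⟨δ₂, hδ₂, H₂⟩ : ∃ δ, 0 < δ ∧ ∀ t ∈ Icc 0 δ, traceNorm j p (w₀.val t - x₀) ≤ r := by
    have h1 := w₀.tendsto_traceNorm_val_sub hp hp' le_rfl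
    rw [hw₀] at h1
    obtain ⟨δ, hδ, H⟩ := Metric.mem_nhdsWithin_iff.1 (h1.eventually_le_const hr)
    refine ⟨δ / 2, half_pos hδ, fun t ht => H ⟨?_, ht.1⟩⟩
    rw [Metric.mem_ball, Real.dist_0_eq_abs, abs_of_nonneg ht.1]
    linarith [ht.2]
  obtain ⟨δ₃, hδ₃, H₃⟩ := exists_lpNormOn_Icc_le hp hp' hφ hr
  -- The inhomogeneity must be of order `r²`, like the other contributions to the self-mapping
  -- estimate.
  obtain ⟨δ₄, hδ₄, H₄⟩ := exists_lpNormOn_Icc_le hp hp' (D.memLp_F hx₀) (mul_pos hr hr)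
  obtain ⟨T, hT, hTT, hT₁, hT₂, hT₃, hT₄⟩ : ∃ T, 0 < T ∧ T ≤ T₀ ∧ T ≤ δ₁ ∧ T ≤ δ₂ ∧ T ≤ δ₃ ∧
      T ≤ δ₄ := by
    refine ⟨min T₀ (min (min δ₁ δ₂) (min δ₃ δ₄)), by positivity, ?_⟩
    simp
  have hsub : Icc 0 T ⊆ Icc 0 T₀ := Icc_subset_Icc_right hTT
  replace hA := fun t (ht : t ∈ Icc 0 T) => hA t (hsub ht)
  replace hF := ae_restrict_of_ae_restrict_of_subset hsub hF
  replace hφ := hφ.mono_measure (Measure.restrict_mono (μ := volume) hsub le_rfl)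
  have hφr : lpNormOn φ p (Icc 0 T) ≤ r := H₃ 0 T hsub (by linarith)
  have hsol := fun x hx hxr => exists_isQuasilinearSolution (x := x) hp hp' D h hT hTT hw₀ hr hC.le
    hφ hA hF (H₁ T hT₁) (fun t ht => H₂ t ⟨ht.1, ht.2.trans hT₂⟩) hφr
    (H₄ 0 T hsub (by linarith)) hc hcr hcr₂ hcr₃ hx hxr
  have hmem : ∀ x ∈ traceSpace j p, ∀ u : MRSpace j p (Icc 0 T), IsQuasilinearSolution A F x u →
      ∀ t ∈ Icc 0 T, u.val t ∈ traceSpace j p :=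
    fun x hx u hu t ht => u.val_mem_traceSpace_of_val_zero_mem (hu.1 ▸ hx) ht
  have hx₀1 : traceNorm j p x₀ ≤ traceNorm j p x₀ + 1 := by linarith
  have hA₀ : ∀ x ∈ traceSpace j p, ∀ u : MRSpace j p (Icc 0 T), IsQuasilinearSolution A F x u →
      (∀ t ∈ Icc 0 T, traceNorm j p (u.val t - x₀) ≤ c * r) →
      ∀ t ∈ Icc 0 T, ∀ y, ‖A t x₀ y - A t (u.val t) y‖ ≤ C * (c * r) * ‖y‖ := by
    intro x hx u hu hur t ht y
    have hm := hmem x hx u hu t ht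
    refine (hA t ht _ hx₀ _ hm hx₀1 (traceNorm_le_add_one hp hm hx₀ hcr (hur t ht)) y).trans ?_
    rw [traceNorm_sub_comm hx₀ hm]
    gcongr
    exact hur t ht
  have hKr : 0 ≤ K * r := by positivity
  have huniq : ∀ x ∈ traceSpace j p, ∀ u v : MRSpace j p (Icc 0 T),
      IsQuasilinearSolution A F x u → (∀ t ∈ Icc 0 T, traceNorm j p (u.val t - x₀) ≤ c * r) →
      IsQuasilinearSolution A F x v → EqOn u.val v.val (Icc 0 T) := by
    intro x hx u v hu hur hv
    refine hu.eqOn hp hp' D h hT hTT hx hv (a := C * (c * r)) (by positivity)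
      (hA₀ x hx u hu hur) ?_
    have : 0 ≤ K * (C * (c * r)) := by positivity
    linarith
  -- By uniqueness every solution coincides with the constructed one and inherits its bounds, so the
  -- Lipschitz estimate applies to arbitrary solutions.
  have hnear : ∀ x ∈ traceSpace j p, traceNorm j p (x - x₀) ≤ r → ∀ u : MRSpace j p (Icc 0 T),
      IsQuasilinearSolution A F x u → lpNormOn u.lift p (Icc 0 T) ≤ c * r ∧
        ∀ t ∈ Icc 0 T, traceNorm j p (u.val t - x₀) ≤ c * r := by
    intro x hx hxr u hu
    obtain ⟨v, hv, hvn, hvr⟩ := hsol x hx hxr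
    have hvu := huniq x hx v u hv hvr hu
    refine ⟨?_, fun t ht => hvu ht ▸ hvr t ht⟩
    rw [← lpNormOn_congr_ae (MRSpace.lift_ae_eq hj_inj measurableSet_Icc hvu)]
    exact v.lpNormOn_lift_le.trans hvn
  refine ⟨T, hT, hTT, r, hr, fun x hx hxr => ?_, 2 * (2 + K * (1 + M)),
    fun x hx y hy hxr hyr u v hu hv => ?_⟩
  · obtain ⟨u, hu, -, hur⟩ := hsol x hx hxr
    exact ⟨u, hu, hmem x hx u hu, fun v hv => (huniq x hx u v hu hur hv).symm⟩
  · obtain ⟨-, hur⟩ := hnear x hx hxr u hu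
    obtain ⟨hvl, hvr⟩ := hnear y hy hyr v hv
    have mu := hmem x hx u hu
    have mv := hmem y hy v hv
    have bu := fun t ht => traceNorm_le_add_one hp (mu t ht) hx₀ hcr (hur t ht)
    have bv := fun t ht => traceNorm_le_add_one hp (mv t ht) hx₀ hcr (hvr t ht)
    refine hu.norm_sub_le hp h hT hTT hx hy hv (a := C * (c * r)) (C := C) (φ := φ) (by positivity)
      hC.le hφ (hA₀ x hx u hu hur)
      (fun t ht => hA t ht _ (mu t ht) _ (mv t ht) (bu t ht) (bv t ht)) ?_ ?_
    · filter_upwards [hF, ae_restrict_mem measurableSet_Icc] with t ht htm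
      exact ht _ (mu t htm) _ (mv t htm) (bu t htm) (bv t htm)
    · have h1 : C * (c * r) + (C * lpNormOn v.lift p (Icc 0 T) + lpNormOn φ p (Icc 0 T)) ≤
          (2 * C * c + 1) * r := by
        have := mul_le_mul_of_nonneg_left hvl hC.le
        linarith
      have h2 := mul_le_mul_of_nonneg_left h1 hK
      linarith
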